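/- Let $n\ge 2$, $0\le d\le n$ and $\gamma>0$. Let $\widetilde G^n_d$ be the oriented Grassmannian of oriented $d$-dimensional linear subspaces of $\mathbb R^n$ (classes of linearly independent frames $(u_1,\dots,u_d)$ modulo matrices of positive determinant), and let $\mathcal V_d$ be the set of oriented $d$-varifolds, i.e. of finite nonnegative Borel measures on $\mathbb R^n\times\widetilde G^n_d$. The weight of $\mu\in\mathcal V_d$ is the measure $|\mu|(A)=\mu(A\times\widetilde G^n_d)$ on $\mathbb R^n$. For a $C^1$-diffeomorphism $\phi$ of $\mathbb R^n$, the pushforward $\phi_\#\mu$ is defined by $$\int\omega\,d(\phi_\#\mu)=\int\omega(\phi(x),d_x\phi\cdot U)\,J_U\phi(x)\,d\mu(x,U),$$ where $d_x\phi\cdot U$ is the oriented space spanned by $(d_x\phi(u_1),\dots,d_x\phi(u_d))$ for a frame $(u_i)$ of $U$, and $J_U\phi(x)=\sqrt{\det(d_x\phi(u_i)\cdot d_x\phi(u_j))_{i,j}}$ for an orthonormal frame $(u_i)$ of $U$. Let $V$ be a Hilbert space of vector fields on $\mathbb R^n$ that is continuously embedded in $C^2_0(\mathbb R^n,\mathbb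 R^n)$, the space of $C^2$ vector fields that vanish at infinity together with their first and second derivatives, with the sup-norm of the field and its derivatives up to order $2$. For $v\in L^2([0,1],V)$ let $\varphi^v_t$ be its flow, $\varphi^v_t(x)=x+\int_0^t v_s(\varphi^v_s(x))\,ds$; each $\varphi^v_t$ is a $C^1$-diffeomorphism. For $\mu\in\mathcal V_d$ and $\eta\in L^2([0,1],L^2(|\mu|))$ let $\tilde\alpha^\eta_t(x)=1+\frac12\int_0^t\eta_s(x)\,ds$. Call $(v,\eta)\in L^2([0,1],V\times L^2(|\mu|))$ admissible for $\mu$ if, for $|\mu|$-a.e. $x$, $\tilde\alpha^\eta_t(x)>0$ for all $t\in[0,1]$; it then joins $\mu$ to $$\big((\tilde\alpha^\eta_1)^2\circ(\varphi^v_1)^{-1}\big)\,(\varphi^v_1)_\#\mu .$$ The orbit $\Theta(\mu)$ is the set of all varifolds to which $\mu$ is joined by some admissible $(v,\eta)$. Let $$C_\mu(v,\eta)=\frac12\int_0^1\|v_t\|_V^2\,dt+\frac\gamma2\int_0^1\int_{\mathbb R^n}\eta_t^2\circ(\varphi^v_t)^{-1}\,d|(\varphi^v_t)_\#\mu|\,dt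 ,$$ and for $\mu,\mu'\in\mathcal V_d$ let $$d_{V\text{-}\mathcal{FR}}(\mu,\mu')^2=\inf C_\mu(v,\eta),$$ the infimum being taken over all $(v,\eta)$ that are admissible for $\mu$ and join $\mu$ to $\mu'$ (with $\inf\emptyset=+\infty$). Theorem. For every $\mu_0\in\mathcal V_d$, the function $d_{V\text{-}\mathcal{FR}}$ is a distance on $\Theta(\mu_0)$: for all $\mu,\mu',\mu''\in\Theta(\mu_0)$, 1. $d_{V\text{-}\mathcal{FR}}(\mu,\mu')<\infty$; 2. $d_{V\text{-}\mathcal{FR}}(\mu,\mu')=d_{V\text{-}\mathcal{FR}}(\mu',\mu)$; 3. $d_{V\text{-}\mathcal{FR}}(\mu,\mu'')\le d_{V\text{-}\mathcal{FR}}(\mu,\mu')+d_{V\text{-}\mathcal{FR}}(\mu',\mu'')$; 4. $d_{V\text{-}\mathcal{FR}}(\mu,\mu')=0$ if and only if $\mu=\mu'$. -/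

import Mathlib

open MeasureTheory Set Filter Topology
open scoped ENNReal

noncomputable section

namespace LddmmFR

/-- The ambient Euclidean space. -/
abbrev E (n : ℕ) := EuclideanSpace ℝ (Fin n)

/-! ### The oriented Grassmannian -/

/-- Frames: linearly independent `d`-tuples of vectors. -/
abbrev Frame (n d : ℕ) := {u : Fin d → E n // LinearIndependent ℝ u}

/-- Two frames span the same oriented subspace iff they are related by a
matrix of positive determinant. -/
def SameOriented {n d : ℕ} (u w : Fin d → E n) : Prop :=
  ∃ A : Matrix (Fin d) (Fin d) ℝ, 0 < A.det ∧ ∀ i, w i = ∑ j, A i j • u j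

theorem sameOriented_comp {n d : ℕ} {A B : Matrix (Fin d) (Fin d) ℝ} {u w z : Fin d → E n}
    (hA : ∀ i, w i = ∑ j, A i j • u j) (hB : ∀ i, z i = ∑ j, B i j • w j) (i : Fin d) :
    z i = ∑ j, (B * A) i j • u j := by
  rw [hB i]
  simp only [hA, Finset.smul_sum, smul_smul, Matrix.mul_apply, Finset.sum_smul]
  exact Finset.sum_comm

instance frameSetoid (n d : ℕ) : Setoid (Frame n d) where
  r u w := SameOriented u.1 w.1
  iseqv :=
    { refl := fun u => ⟨1, by simp, fun i => by simp [Matrix.one_apply]⟩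
      symm := by
        rintro u w ⟨A, hA, h⟩
        have hu : IsUnit A.det := hA.ne'.isUnit
        refine ⟨A⁻¹, ?_, fun i => ?_⟩
        · rw [Matrix.det_nonsing_inv, Ring.inverse_eq_inv']
          exact inv_pos.mpr hA
        · have h2 := sameOriented_comp (z := fun i => ∑ j, A⁻¹ i j • w.1 j) h (fun _ => rfl) i
          rw [Matrix.nonsing_inv_mul A hu] at h2
          simpa [Matrix.one_apply] using h2.symm
      trans := by
        rintro u w z ⟨A, hA, h⟩ ⟨B, hB, h'⟩
        exact ⟨B * A, by rw [Matrix.det_mul]; exact mul_pos hB hA, sameOriented_comp h h'⟩ }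

/-- The oriented Grassmannian of oriented `d`-dimensional linear subspaces of `ℝⁿ`. -/
def OrientedGrassmannian (n d : ℕ) : Type := Quotient (frameSetoid n d)

/-- The usual topology, as the quotient of the (open) set of frames. -/
instance (n d : ℕ) : TopologicalSpace (OrientedGrassmannian n d) :=
  inferInstanceAs (TopologicalSpace (Quotient (frameSetoid n d)))

instance (n d : ℕ) : MeasurableSpace (OrientedGrassmannian n d) := borel _

instance (n d : ℕ) : BorelSpace (OrientedGrassmannian n d) := ⟨rfl⟩

theorem sameOriented_map {n d : ℕ} (L : E n →L[ℝ] E n) {u w : Fin d → E n}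
    (h : SameOriented u w) : SameOriented (fun i => L (u i)) (fun i => L (w i)) := by
  obtain ⟨A, hA, h⟩ := h
  exact ⟨A, hA, fun i => by simp [h i]⟩

open Classical in
/-- The oriented subspace `L · U`, spanned by the image under `L` of a frame of `U`.
Only injective `L` matter; the value for other `L` is a placeholder. -/
def transport {n d : ℕ} (L : E n →L[ℝ] E n) (U : OrientedGrassmannian n d) :
    OrientedGrassmannian n d :=
  if hL : Function.Injective L then
    Quotient.map (sa := frameSetoid n d) (sb := frameSetoid n d)
      (fun u : Frame n d => (⟨fun i => L (u.1 i),
        u.2.map' (L : E n →ₗ[ℝ] E n) (LinearMap.ker_eq_bot.mpr hL)⟩ : Frame n d))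
      (fun _ _ h => sameOriented_map L h) U
  else U

/-- The `d`-volume of the parallelepiped spanned by a tuple of vectors. -/
def frameVolume {n d : ℕ} (u : Fin d → E n) : ℝ :=
  Real.sqrt (Matrix.gram ℝ u).det

theorem frameVolume_comp {n d : ℕ} {A : Matrix (Fin d) (Fin d) ℝ} {u w : Fin d → E n}
    (h : ∀ i, w i = ∑ j, A i j • u j) : frameVolume w = |A.det| * frameVolume u := by
  have hg : Matrix.gram ℝ w = A * Matrix.gram ℝ u * A.transpose := by
    ext i j
    simp only [Matrix.gram_apply, Matrix.mul_apply, Matrix.transpose_apply, h, sum_inner,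
      inner_sum, real_inner_smul_left, real_inner_smul_right, Finset.sum_mul]
    exact Finset.sum_congr rfl fun k _ => Finset.sum_congr rfl fun l _ => by ring
  rw [frameVolume, frameVolume, hg, Matrix.det_mul, Matrix.det_mul, Matrix.det_transpose,
    show A.det * (Matrix.gram ℝ u).det * A.det = A.det ^ 2 * (Matrix.gram ℝ u).det by ring,
    Real.sqrt_mul (sq_nonneg _), Real.sqrt_sq_eq_abs]

/-- The Jacobian of `L` along `U`: the ratio of the `d`-volumes of `L u` and of `u`, for any frame
`u` of `U`. For an orthonormal frame the denominator is `1`. -/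
def jacobian {n d : ℕ} (L : E n →L[ℝ] E n) (U : OrientedGrassmannian n d) : ℝ :=
  Quotient.lift (s := frameSetoid n d)
    (fun u : Frame n d => frameVolume (fun i => L (u.1 i)) / frameVolume u.1)
    (by
      rintro u w ⟨A, hA, h⟩
      have h' : ∀ i, L (w.1 i) = ∑ j, A i j • L (u.1 j) := fun i => by simp [h i]
      have hd : |A.det| ≠ 0 := abs_ne_zero.mpr hA.ne'
      rw [frameVolume_comp h, frameVolume_comp h', mul_div_mul_left _ _ hd]) U

/-! ### Varifolds -/

/-- Oriented `d`-varifolds on `ℝⁿ`: finite Borel measures on `ℝⁿ × G̃`. (Such measures are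
automatically Radon, the space being locally compact and second countable.) -/
abbrev Varifold (n d : ℕ) := FiniteMeasure (E n × OrientedGrassmannian n d)

/-- The weight measure `|μ|` on `ℝⁿ`. -/
def weight {n d : ℕ} (μ : Measure (E n × OrientedGrassmannian n d)) : Measure (E n) :=
  μ.map Prod.fst

/-- The varifold pushforward of `μ` by `φ`: the measure `ν` with
`∫ ω dν = ∫ ω(φ x, d_xφ · U) J_U φ(x) dμ(x, U)`. -/
def pushforward {n d : ℕ} (φ : E n → E n) (μ : Measure (E n × OrientedGrassmannian n d)) :
    Measure (E n × OrientedGrassmannian n d) :=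
  (μ.withDensity fun p => ENNReal.ofReal (jacobian (fderiv ℝ φ p.1) p.2)).map
    fun p => (φ p.1, transport (fderiv ℝ φ p.1) p.2)

/-- The rescaled measure `α μ`, for a weight change `α` on `ℝⁿ`. -/
def rescale {n d : ℕ} (α : E n → ℝ) (μ : Measure (E n × OrientedGrassmannian n d)) :
    Measure (E n × OrientedGrassmannian n d) :=
  μ.withDensity fun p => ENNReal.ofReal (α p.1)

/-! ### Controls and admissible paths -/

/-- A realisation of the Hilbert space `V` as a space of vector fields on `ℝⁿ`, continuously
embedded in `C²₀(ℝⁿ, ℝⁿ)`. -/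
structure FieldSpace (n : ℕ) (V : Type*) [NormedAddCommGroup V] [InnerProductSpace ℝ V] where
  /-- the vector field given by an element of `V` -/
  field : V →ₗ[ℝ] (E n → E n)
  injective : Function.Injective field
  contDiff : ∀ u, ContDiff ℝ 2 (field u)
  vanish : ∀ u, ∀ k ≤ 2,
    Tendsto (fun x => ‖iteratedFDeriv ℝ k (field u) x‖) (cocompact (E n)) (𝓝 0)
  bound : ∃ c > 0, ∀ u, ∀ k ≤ 2, ∀ x, ‖iteratedFDeriv ℝ k (field u) x‖ ≤ c * ‖u‖

/-- Lebesgue measure on `[0,1]`. -/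
def unitTime : Measure ℝ := volume.restrict (Icc 0 1)

/-- `φ` is the flow on `[0,1]` of the time-dependent vector field `v`:
`φ_t(x) = x + ∫₀ᵗ v_s(φ_s(x)) ds`. -/
def IsFlow {n : ℕ} {V : Type*} [NormedAddCommGroup V] [InnerProductSpace ℝ V]
    (F : FieldSpace n V) (v : ℝ → V) (φ : ℝ → E n → E n) : Prop :=
  ∀ x, ContinuousOn (fun t => φ t x) (Icc 0 1) ∧
    ∀ t ∈ Icc (0 : ℝ) 1, φ t x = x + ∫ s in (0 : ℝ)..t, F.field (v s) (φ s x)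

/-- The square root of the weight change, `α̃_t(x) = 1 + ½ ∫₀ᵗ η_s(x) ds`. -/
def sqrtWeight {n : ℕ} (η : ℝ → E n → ℝ) (t : ℝ) (x : E n) : ℝ :=
  1 + (1 / 2) * ∫ s in (0 : ℝ)..t, η s x

/-- `(v, η) ∈ L²([0,1], V × L²(|μ|))`, `φ` is the flow of `v`, and the weight change stays strictly
positive. Here `L²([0,1], L²(|μ|))` is `L²(dt ⊗ |μ|)`. -/
structure Admissible {n d : ℕ} {V : Type*} [NormedAddCommGroup V] [InnerProductSpace ℝ V]
    (F : FieldSpace n V) (μ : Varifold n d) (v : ℝ → V) (φ : ℝ → E n → E n)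
    (η : ℝ → E n → ℝ) : Prop where
  memLp_field : MemLp v 2 unitTime
  isFlow : IsFlow F v φ
  memLp_weight : MemLp (Function.uncurry η) 2 (unitTime.prod (weight μ.toMeasure))
  pos : ∀ᵐ x ∂(weight μ.toMeasure), ∀ t ∈ Icc (0 : ℝ) 1, 0 < sqrtWeight η t x

/-- The transformed varifold `μ_t = ((α̃_t)² ∘ φ_t⁻¹) (φ_t)_# μ`. -/
def transformed {n d : ℕ} (μ : Varifold n d) (φ : ℝ → E n → E n) (η : ℝ → E n → ℝ) (t : ℝ) :
    Measure (E n × OrientedGrassmannian n d) :=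
  rescale (fun x => (sqrtWeight η t (Function.invFun (φ t) x)) ^ 2)
    (pushforward (φ t) μ.toMeasure)

/-- The orbit `Θ(μ)`. -/
def orbit {n d : ℕ} {V : Type*} [NormedAddCommGroup V] [InnerProductSpace ℝ V]
    (F : FieldSpace n V) (μ : Varifold n d) : Set (Varifold n d) :=
  {ν | ∃ v φ η, Admissible F μ v φ η ∧ ν.toMeasure = transformed μ φ η 1}

/-- The LDDMM-Fisher-Rao energy
`½ ∫₀¹ ‖v_t‖² dt + γ/2 ∫₀¹ ∫ (η_t)² ∘ φ_t⁻¹ d|(φ_t)_# μ| dt`. -/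
def energy {n d : ℕ} {V : Type*} [NormedAddCommGroup V] (γ : ℝ) (μ : Varifold n d) (v : ℝ → V)
    (φ : ℝ → E n → E n) (η : ℝ → E n → ℝ) : ℝ≥0∞ :=
  ENNReal.ofReal (1 / 2) * (∫⁻ t, ENNReal.ofReal (‖v t‖ ^ 2) ∂unitTime) +
    ENNReal.ofReal (γ / 2) *
      ∫⁻ t, ∫⁻ x, ENNReal.ofReal ((η t (Function.invFun (φ t) x)) ^ 2)
        ∂(weight (pushforward (φ t) μ.toMeasure)) ∂unitTime

/-- The LDDMM-Fisher-Rao distance: the square root of the infimum of the energy over the admissible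
paths from `μ` to `ν` (`∞` if there is none). -/
def distFR {n d : ℕ} {V : Type*} [NormedAddCommGroup V] [InnerProductSpace ℝ V]
    (F : FieldSpace n V) (γ : ℝ) (μ ν : Varifold n d) : ℝ≥0∞ :=
  (sInf {c : ℝ≥0∞ | ∃ v φ η, Admissible F μ v φ η ∧ ν.toMeasure = transformed μ φ η 1 ∧
    c = energy γ μ v φ η}) ^ (1 / 2 : ℝ)

end LddmmFR

end

open MeasureTheory Set Filter Topology
open scoped ENNReal

noncomputable section

namespace LddmmFR

/-! ### Calculus preliminaries -/

/-! The triangle inequality and symmetry come from operations on paths: reversal preserves the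
energy, and concatenation run on `[0, l]` and `[l, 1]` turns energies `c`, `c'` into `c / l + c' /
(1 - l)`. Minimising over `l` gives `(√c + √c')²`, which is the triangle inequality for the square
root of the infimum. Both operations rest on the square root of the weight change. Along a
concatenation these square roots multiply, `α̃_t = α̃_1 · (α̃'_s ∘ φ_1)`, so the second control
becomes `α̃_1 · (η' ∘ φ_1)` up to the time factor. The square `α̃_1²` is exactly the density by
which the mass of the intermediate varifold differs from the transported initial one, so the
quadratic energies agree (`Admissible.lintegral_tilt`). Reversal divides by `α̃_1`, and here strict
positivity is used. The results are `Joins.symm` and `Joins.trans`; finiteness on the orbit follows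
by going through the base varifold.

All this needs the flow to act on varifolds, so any flow of an `L²` control has to be shown to be a
`C¹`-diffeomorphism (`IsFlow.isDiffeo`). Instead of differentiating the equation, Grönwall's
inequality is applied to first and second differences of trajectories. This gives two-sided
Lipschitz bounds and a bound `C ‖p‖ ‖q‖` on second differences, and `contDiff_one_of_secondDiff_le`
converts the latter into `C¹` regularity. The same bounds control the Jacobians along planes from
above and below, so finite energy and `η ∈ L²` are equivalent (`IsFlow.memLp_weight_iff`).

For separation, suppose that paths of arbitrarily small energy join `μ` to `ν`. Their endpoints
`φ_1` and derivatives converge pointwise to the identity, and the final square-root weights converge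
to `1` in `L²(|μ|)`, hence almost everywhere along a subsequence. Fatou's lemma gives `μ O ≤ ν O`
for each open `O`; by symmetry the measures agree on open sets, hence everywhere. -/

/-- Post-composition of an absolutely continuous function with a Lipschitz one. -/
theorem absolutelyContinuousOnInterval_comp_of_lipschitzOnWith {f g : ℝ → ℝ} {a b : ℝ}
    {K : NNReal} {s : Set ℝ} (hg : LipschitzOnWith K g s)
    (hf : AbsolutelyContinuousOnInterval f a b) (hs : ∀ x ∈ uIcc a b, f x ∈ s) :
    AbsolutelyContinuousOnInterval (fun x => g (f x)) a b := by
  rw [absolutelyContinuousOnInterval_iff] at hf ⊢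
  intro ε hε
  obtain ⟨δ, hδ, H⟩ := hf (ε / (K + 1)) (by positivity)
  refine ⟨δ, hδ, fun I hI hIδ => ?_⟩
  have h1 := H I hI hIδ
  have hmem := hI
  simp only [AbsolutelyContinuousOnInterval.disjWithin, mem_ofPred_eq, Finset.mem_range] at hmem
  calc ∑ i ∈ Finset.range I.1, dist (g (f (I.2 i).1)) (g (f (I.2 i).2))
      ≤ ∑ i ∈ Finset.range I.1, K * dist (f (I.2 i).1) (f (I.2 i).2) := by
        refine Finset.sum_le_sum fun i hi => ?_
        have := hmem.1 i (Finset.mem_range.1 hi)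
        exact hg.dist_le_mul _ (hs _ this.1) _ (hs _ this.2)
    _ = K * ∑ i ∈ Finset.range I.1, dist (f (I.2 i).1) (f (I.2 i).2) := by
        rw [Finset.mul_sum]
    _ ≤ (K + 1) * ∑ i ∈ Finset.range I.1, dist (f (I.2 i).1) (f (I.2 i).2) := by
        have : 0 ≤ ∑ i ∈ Finset.range I.1, dist (f (I.2 i).1) (f (I.2 i).2) :=
          Finset.sum_nonneg fun _ _ => dist_nonneg
        nlinarith
    _ < (K + 1) * (ε / (K + 1)) := by
        have : (0 : ℝ) < K + 1 := by positivity
        gcongr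
    _ = ε := by field_simp

/-- Grönwall's inequality in integral form, with an integrable coefficient. -/
theorem le_mul_exp_of_le_add_integral {u g : ℝ → ℝ} {C T : ℝ} (hT : 0 ≤ T)
    (hu : ContinuousOn u (Icc 0 T)) (hg : IntervalIntegrable g volume 0 T)
    (hg0 : ∀ s, 0 ≤ g s)
    (h : ∀ t ∈ Icc 0 T, u t ≤ C + ∫ s in (0 : ℝ)..t, g s * u s) :
    u T ≤ C * Real.exp (∫ s in (0 : ℝ)..T, g s) := by
  have hu' : ContinuousOn u (uIcc 0 T) := by rwa [uIcc_of_le hT]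
  have hgu : IntervalIntegrable (fun s => g s * u s) volume 0 T := hg.mul_continuousOn hu'
  set a : ℝ → ℝ := fun t => ∫ s in (0 : ℝ)..t, g s with ha
  set p : ℝ → ℝ := fun t => ∫ s in (0 : ℝ)..t, g s * u s with hp
  have haAC : AbsolutelyContinuousOnInterval a 0 T :=
    hg.absolutelyContinuousOnInterval_intervalIntegral left_mem_uIcc
  have hpAC : AbsolutelyContinuousOnInterval p 0 T :=
    hgu.absolutelyContinuousOnInterval_intervalIntegral left_mem_uIcc
  have hCAC : AbsolutelyContinuousOnInterval (fun _ : ℝ => C) 0 T :=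
    (LipschitzWith.const C).lipschitzOnWith.absolutelyContinuousOnInterval (K := 0)
  have hhAC : AbsolutelyContinuousOnInterval (fun t => C + p t) 0 T := hCAC.fun_add hpAC
  have ha0 : ∀ t ∈ uIcc 0 T, -a t ∈ Iic (0 : ℝ) := by
    intro t ht
    rw [uIcc_of_le hT] at ht
    simpa [ha] using intervalIntegral.integral_nonneg ht.1 fun s _ => hg0 s
  -- Since `g ≥ 0`, the function `-a` takes values in the half-line where `exp` is `1`-Lipschitz, so
  -- `exp (-a)` is absolutely continuous.
  have hexpL : LipschitzOnWith 1 Real.exp (Iic 0) := by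
    refine Convex.lipschitzOnWith_of_nnnorm_deriv_le (fun x _ => Real.differentiableAt_exp)
      (fun x hx => ?_) (convex_Iic 0)
    rw [Real.deriv_exp, ← NNReal.coe_le_coe, coe_nnnorm, Real.norm_of_nonneg (Real.exp_nonneg x)]
    simpa using hx
  have heAC : AbsolutelyContinuousOnInterval (fun t => Real.exp (-a t)) 0 T :=
    absolutelyContinuousOnInterval_comp_of_lipschitzOnWith hexpL haAC.fun_neg ha0
  -- The coefficient is only integrable, so derivatives exist only almost everywhere. Absolute
  -- continuity still recovers the increment of `(C + p) exp (-a)` from its derivative `-g (C + p -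
  -- u) exp (-a) ≤ 0`.
  have key := hhAC.integral_deriv_mul_eq_sub heAC
  have hle : ∫ x in (0 : ℝ)..T, (deriv (fun t => C + p t) x * Real.exp (-a x) +
      (C + p x) * deriv (fun t => Real.exp (-a t)) x) ≤ 0 := by
    rw [← neg_nonneg, ← intervalIntegral.integral_neg]
    refine intervalIntegral.integral_nonneg_of_ae_restrict hT ?_
    filter_upwards [ae_restrict_of_ae hg.ae_hasDerivAt_integral,
      ae_restrict_of_ae hgu.ae_hasDerivAt_integral, ae_restrict_mem measurableSet_Icc]
      with t h1 h2 ht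
    have ht' : t ∈ uIcc 0 T := by rwa [uIcc_of_le hT]
    have da : HasDerivAt a (g t) t := h1 ht' 0 left_mem_uIcc
    have dp : HasDerivAt p (g t * u t) t := h2 ht' 0 left_mem_uIcc
    rw [(dp.const_add C).deriv, da.fun_neg.exp.deriv]
    have h3 : 0 ≤ g t * Real.exp (-a t) := mul_nonneg (hg0 t) (Real.exp_nonneg _)
    have h4 := mul_nonneg h3 (sub_nonneg.2 (h t ht))
    change 0 ≤ g t * Real.exp (-a t) * (C + p t - u t) at h4
    simp only [Pi.zero_apply]
    linarith
  rw [key] at hle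
  have h0 : p 0 = 0 := by simp [hp]
  have ha00 : a 0 = 0 := by simp [ha]
  rw [h0, ha00] at hle
  have hTle := h T ⟨hT, le_rfl⟩
  have h2 : (C + p T) * Real.exp (-a T) ≤ C := by simpa using hle
  calc u T ≤ C + p T := hTle
    _ = (C + p T) * Real.exp (-a T) * Real.exp (a T) := by
        rw [mul_assoc, ← Real.exp_add]; simp
    _ ≤ C * Real.exp (a T) := by gcongr


/-! ### `C¹` regularity from second differences -/

section SecondDifference

variable {X Y : Type*} [NormedAddCommGroup X] [NormedSpace ℝ X] [NormedAddCommGroup Y]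
  [NormedSpace ℝ Y] {f : X → Y} {C L : ℝ}

/-- The dyadic difference quotients of `f` at `x` in the direction `e`. -/
def dyadicQuotient (f : X → Y) (x e : X) (k : ℕ) : Y :=
  (2 : ℝ) ^ k • (f (x + ((2 : ℝ) ^ k)⁻¹ • e) - f x)

/-- Two consecutive quotients differ by `2 ^ k` times a second difference with both steps equal to
`2 ^ (-k-1) e`. The bound is left in the unsimplified form that the geometric Cauchy criterion
takes. -/
theorem dist_dyadicQuotient_succ_le
    (hC : ∀ x p q, ‖f (x + p + q) - f (x + p) - f (x + q) + f x‖ ≤ C * ‖p‖ * ‖q‖)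
    (x e : X) (k : ℕ) :
    dist (dyadicQuotient f x e k) (dyadicQuotient f x e (k + 1)) ≤
      (C * ‖e‖ ^ 2 / 2) / 2 / 2 ^ k := by
  set p : X := ((2 : ℝ) ^ (k + 1))⁻¹ • e with hp
  have h2 : ((2 : ℝ) ^ k)⁻¹ • e = p + p := by
    rw [hp, ← add_smul, pow_succ]
    congr 1
    field_simp
    norm_num
  have hnp : ‖p‖ = ‖e‖ / 2 ^ (k + 1) := by
    rw [hp, norm_smul, norm_inv, norm_pow, Real.norm_ofNat, inv_mul_eq_div]
  have : dyadicQuotient f x e k - dyadicQuotient f x e (k + 1) =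
      (2 : ℝ) ^ k • (f (x + p + p) - f (x + p) - f (x + p) + f x) := by
    rw [dyadicQuotient, dyadicQuotient, h2, ← hp, ← add_assoc, pow_succ]
    module
  rw [dist_eq_norm, this, norm_smul, norm_pow, Real.norm_ofNat]
  calc (2 : ℝ) ^ k * ‖f (x + p + p) - f (x + p) - f (x + p) + f x‖
      ≤ 2 ^ k * (C * ‖p‖ * ‖p‖) := by gcongr; exact hC x p p
    _ = _ := by
      rw [hnp, pow_succ]
      field_simp

/-- A Lipschitz map whose second differences are bounded by `C ‖p‖ ‖q‖` is of class `C¹`. -/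
theorem contDiff_one_of_secondDiff_le [CompleteSpace Y]
    (hL : ∀ x y, ‖f x - f y‖ ≤ L * ‖x - y‖)
    (hC : ∀ x p q, ‖f (x + p + q) - f (x + p) - f (x + q) + f x‖ ≤ C * ‖p‖ * ‖q‖) :
    ContDiff ℝ 1 f := by
  have hex : ∀ x e, ∃ w, Tendsto (dyadicQuotient f x e) atTop (𝓝 w) := fun x e =>
    cauchySeq_tendsto_of_complete
      (cauchySeq_of_le_geometric_two (dist_dyadicQuotient_succ_le hC x e))
  choose w hw using hex
  have hsmall : ∀ M : ℝ, Tendsto (fun k : ℕ => M / 2 ^ k) atTop (𝓝 0) := fun M =>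
    tendsto_const_nhds.div_atTop (tendsto_pow_atTop_atTop_of_one_lt one_lt_two)
  have hnorm : ∀ (k : ℕ) (e : X), ‖((2 : ℝ) ^ k)⁻¹ • e‖ = ‖e‖ / 2 ^ k := fun k e => by
    rw [norm_smul, norm_inv, norm_pow, Real.norm_ofNat, inv_mul_eq_div]
  -- The additivity defect of the `k`-th quotient is `2 ^ k` times a second difference with steps of
  -- order `2 ^ (-k)`, so it vanishes in the limit.
  have hadd : ∀ x e e', w x (e + e') = w x e + w x e' := by
    intro x e e'
    have ht := ((hw x (e + e')).sub (hw x e)).sub (hw x e')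
    have h0 : Tendsto (fun k => dyadicQuotient f x (e + e') k - dyadicQuotient f x e k -
        dyadicQuotient f x e' k) atTop (𝓝 0) := by
      refine squeeze_zero_norm (fun k => ?_) (hsmall (C * ‖e‖ * ‖e'‖))
      have : dyadicQuotient f x (e + e') k - dyadicQuotient f x e k - dyadicQuotient f x e' k =
          (2 : ℝ) ^ k • (f (x + ((2 : ℝ) ^ k)⁻¹ • e + ((2 : ℝ) ^ k)⁻¹ • e') -
            f (x + ((2 : ℝ) ^ k)⁻¹ • e) - f (x + ((2 : ℝ) ^ k)⁻¹ • e') + f x) := by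
        rw [dyadicQuotient, dyadicQuotient, dyadicQuotient, smul_add, ← add_assoc]
        module
      rw [this, norm_smul, norm_pow, Real.norm_ofNat]
      calc _ ≤ (2 : ℝ) ^ k * (C * ‖((2 : ℝ) ^ k)⁻¹ • e‖ * ‖((2 : ℝ) ^ k)⁻¹ • e'‖) := by
            gcongr; exact hC x _ _
        _ = _ := by rw [hnorm, hnorm]; field_simp
    have := tendsto_nhds_unique ht h0
    rw [sub_sub, sub_eq_zero] at this
    exact this
  have hbd : ∀ x e, ‖w x e‖ ≤ L * ‖e‖ := by
    intro x e
    refine le_of_tendsto (hw x e).norm (Eventually.of_forall fun k => ?_)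
    rw [dyadicQuotient, norm_smul, norm_pow, Real.norm_ofNat]
    calc _ ≤ (2 : ℝ) ^ k * (L * ‖x + ((2 : ℝ) ^ k)⁻¹ • e - x‖) := by gcongr; exact hL _ _
      _ = _ := by rw [add_sub_cancel_left, hnorm]; field_simp
  -- Moving the base point also produces a second difference, now with steps `y - x` and `2 ^ (-k)
  -- e`; hence the candidate derivative is Lipschitz in `x`.
  have hdiff : ∀ x y e, ‖w x e - w y e‖ ≤ C * ‖y - x‖ * ‖e‖ := by
    intro x y e
    refine le_of_tendsto ((hw x e).sub (hw y e)).norm (Eventually.of_forall fun k => ?_)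
    have : dyadicQuotient f x e k - dyadicQuotient f y e k = -((2 : ℝ) ^ k •
        (f (x + (y - x) + ((2 : ℝ) ^ k)⁻¹ • e) - f (x + (y - x)) -
          f (x + ((2 : ℝ) ^ k)⁻¹ • e) + f x)) := by
      rw [dyadicQuotient, dyadicQuotient, add_sub_cancel]
      module
    rw [this, norm_neg, norm_smul, norm_pow, Real.norm_ofNat]
    calc _ ≤ (2 : ℝ) ^ k * (C * ‖y - x‖ * ‖((2 : ℝ) ^ k)⁻¹ • e‖) := by gcongr; exact hC x _ _
      _ = _ := by rw [hnorm]; field_simp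
  -- The increment of `f` is the quotient at `k = 0`, and its distance to the limit is the sum of
  -- the geometric series.
  have happrox : ∀ x e, ‖f (x + e) - f x - w x e‖ ≤ C * ‖e‖ ^ 2 / 2 := by
    intro x e
    have := dist_le_of_le_geometric_two_of_tendsto₀ (dist_dyadicQuotient_succ_le hC x e) (hw x e)
    simpa [dyadicQuotient, dist_eq_norm] using this
  -- A continuous additive map between real normed spaces is linear, so homogeneity of `w x` needs
  -- no separate argument.
  let A : X → X →+ Y := fun x => AddMonoidHom.mk' (w x) (hadd x)
  have hA : ∀ x, Continuous (A x) := fun x =>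
    AddMonoidHomClass.continuous_of_bound (A x) L (hbd x)
  let D : X → X →L[ℝ] Y := fun x => (A x).toRealLinearMap (hA x)
  have hD : ∀ x, HasFDerivAt f (D x) x := by
    intro x
    rw [hasFDerivAt_iff_isLittleO_nhds_zero]
    refine Asymptotics.IsBigO.trans_isLittleO (g := fun h : X => ‖h‖ ^ 2) ?_ ?_
    · refine Asymptotics.IsBigO.of_bound (C / 2) (Eventually.of_forall fun h => ?_)
      rw [Real.norm_of_nonneg (by positivity)]
      have := happrox x h
      change ‖f (x + h) - f x - w x h‖ ≤ _
      linarith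
    · exact Asymptotics.isLittleO_norm_pow_id one_lt_two
  rw [contDiff_one_iff_fderiv]
  refine ⟨fun x => (hD x).differentiableAt, ?_⟩
  have hfd : fderiv ℝ f = D := funext fun x => (hD x).fderiv
  rw [hfd]
  refine continuous_iff_continuousAt.2 fun x => ?_
  rw [ContinuousAt, tendsto_iff_norm_sub_tendsto_zero]
  refine squeeze_zero (g := fun y => |C| * ‖x - y‖) (fun _ => norm_nonneg _) (fun y => ?_) ?_
  · refine ContinuousLinearMap.opNorm_le_bound _ (by positivity) fun e => ?_
    change ‖w y e - w x e‖ ≤ _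
    refine (hdiff y x e).trans ?_
    gcongr
    exact le_abs_self C
  · have : Continuous fun y => |C| * ‖x - y‖ := by fun_prop
    simpa using this.tendsto x

end SecondDifference

/-- The derivative of an expanding map is expanding. -/
theorem norm_le_mul_norm_fderiv_apply {X Y : Type*} [NormedAddCommGroup X] [NormedSpace ℝ X]
    [NormedAddCommGroup Y] [NormedSpace ℝ Y] {f : X → Y} {K : ℝ}
    (hK : ∀ x y, ‖x - y‖ ≤ K * ‖f x - f y‖) {x : X} (hf : DifferentiableAt ℝ f x) (e : X) :
    ‖e‖ ≤ K * ‖fderiv ℝ f x e‖ := by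
  refine ge_of_tendsto ((hf.hasFDerivAt.lim_real e).norm.const_mul K) ?_
  filter_upwards [eventually_gt_atTop 0] with c hc
  have := hK (x + c⁻¹ • e) x
  rw [add_sub_cancel_left, norm_smul, norm_inv, Real.norm_of_nonneg hc.le] at this
  rw [norm_smul, Real.norm_of_nonneg hc.le]
  calc ‖e‖ = c * (c⁻¹ * ‖e‖) := by field_simp
    _ ≤ c * (K * ‖f (x + c⁻¹ • e) - f x‖) := by gcongr
    _ = _ := by ring

/-! ### Flows -/

section Flow

variable {n : ℕ} {V : Type*} [NormedAddCommGroup V] [InnerProductSpace ℝ V]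

/-- A constant of the embedding of `V` into `C²₀`. -/
def FieldSpace.embConst (F : FieldSpace n V) : ℝ := F.bound.choose

theorem FieldSpace.embConst_pos (F : FieldSpace n V) : 0 < F.embConst := F.bound.choose_spec.1

theorem FieldSpace.norm_iteratedFDeriv_le (F : FieldSpace n V) (u : V) {k : ℕ} (hk : k ≤ 2)
    (x : E n) : ‖iteratedFDeriv ℝ k (F.field u) x‖ ≤ F.embConst * ‖u‖ :=
  F.bound.choose_spec.2 u k hk x

theorem FieldSpace.norm_field_le (F : FieldSpace n V) (u : V) (x : E n) :
    ‖F.field u x‖ ≤ F.embConst * ‖u‖ := by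
  simpa using F.norm_iteratedFDeriv_le u (k := 0) (by norm_num) x

theorem FieldSpace.norm_field_sub_le (F : FieldSpace n V) (u : V) (x y : E n) :
    ‖F.field u x - F.field u y‖ ≤ F.embConst * ‖u‖ * ‖x - y‖ := by
  refine convex_univ.norm_image_sub_le_of_norm_fderiv_le (𝕜 := ℝ)
    (fun z _ => ((F.contDiff u).differentiable (by norm_num)).differentiableAt) (fun z _ => ?_)
    (mem_univ y) (mem_univ x)
  simpa [norm_iteratedFDeriv_one] using F.norm_iteratedFDeriv_le u (k := 1) (by norm_num) z

theorem FieldSpace.norm_fderiv_sub_le (F : FieldSpace n V) (u : V) (x y : E n) :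
    ‖fderiv ℝ (F.field u) x - fderiv ℝ (F.field u) y‖ ≤ F.embConst * ‖u‖ * ‖x - y‖ := by
  have hd : ContDiff ℝ 1 (fderiv ℝ (F.field u)) :=
    (F.contDiff u).fderiv_right (by norm_num)
  refine convex_univ.norm_image_sub_le_of_norm_fderiv_le (𝕜 := ℝ)
    (fun z _ => (hd.differentiable (by norm_num)).differentiableAt) (fun z _ => ?_)
    (mem_univ y) (mem_univ x)
  rw [← norm_iteratedFDeriv_one, norm_iteratedFDeriv_fderiv]
  exact F.norm_iteratedFDeriv_le u (by norm_num) z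

/-- The mean value inequality for `y ↦ F.field u (y + q) - F.field u y`, whose derivative is small
because that of the field is Lipschitz. -/
theorem FieldSpace.norm_field_secondDiff_le (F : FieldSpace n V) (u : V) (a p q : E n) :
    ‖F.field u (a + p + q) - F.field u (a + p) - F.field u (a + q) + F.field u a‖ ≤
      F.embConst * ‖u‖ * ‖p‖ * ‖q‖ := by
  have hd : Differentiable ℝ (F.field u) := (F.contDiff u).differentiable (by norm_num)
  have hd' : ∀ z, HasFDerivAt (fun y => F.field u (y + q) - F.field u y)
      (fderiv ℝ (F.field u) (z + q) - fderiv ℝ (F.field u) z) z := fun z => by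
    have h := (hd (z + q)).hasFDerivAt.comp z ((hasFDerivAt_id z).add_const q)
    rw [ContinuousLinearMap.comp_id] at h
    exact h.fun_sub (hd z).hasFDerivAt
  have := convex_univ.norm_image_sub_le_of_norm_fderiv_le (𝕜 := ℝ)
    (f := fun y => F.field u (y + q) - F.field u y) (C := F.embConst * ‖u‖ * ‖q‖)
    (fun z _ => (hd' z).differentiableAt) (fun z _ => ?_) (mem_univ a) (mem_univ (a + p))
  · calc _ = ‖F.field u (a + p + q) - F.field u (a + p) - (F.field u (a + q) - F.field u a)‖ := by
          congr 1; abel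
      _ ≤ _ := this
      _ = _ := by rw [add_sub_cancel_left]; ring
  · rw [(hd' z).fderiv]
    simpa using F.norm_fderiv_sub_le u (z + q) z

/-- Joint continuity makes `s ↦ F.field (v s) (γ s)` strongly measurable when `v` is so only almost
everywhere. -/
theorem FieldSpace.continuous_field (F : FieldSpace n V) :
    Continuous fun p : V × E n => F.field p.1 p.2 := by
  refine continuous_iff_continuousAt.2 fun p => ?_
  rw [ContinuousAt, tendsto_iff_norm_sub_tendsto_zero]
  refine squeeze_zero
    (g := fun q : V × E n => F.embConst * ‖q.1 - p.1‖ + F.embConst * ‖p.1‖ * ‖q.2 - p.2‖)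
    (fun _ => norm_nonneg _) (fun q => ?_) ?_
  · have h1 := F.norm_field_le (q.1 - p.1) q.2
    have h2 := F.norm_field_sub_le p.1 q.2 p.2
    rw [map_sub, Pi.sub_apply] at h1
    calc _ = ‖(F.field q.1 q.2 - F.field p.1 q.2) + (F.field p.1 q.2 - F.field p.1 p.2)‖ := by
          congr 1; abel
      _ ≤ _ := (norm_add_le _ _).trans (add_le_add h1 h2)
  · have : Continuous fun q : V × E n =>
        F.embConst * ‖q.1 - p.1‖ + F.embConst * ‖p.1‖ * ‖q.2 - p.2‖ := by fun_prop
    simpa using this.tendsto p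

instance : IsFiniteMeasure unitTime := by unfold unitTime; infer_instance

theorem integrableOn_norm_of_memLp {V : Type*} [NormedAddCommGroup V] {v : ℝ → V} (hv : MemLp v 2 unitTime) :
    IntegrableOn (fun s => ‖v s‖) (Icc 0 1) :=
  (hv.integrable one_le_two).norm

theorem integrableOn_field_comp (F : FieldSpace n V) {v : ℝ → V} (hv : MemLp v 2 unitTime)
    {γ : ℝ → E n} (hγ : ContinuousOn γ (Icc 0 1)) :
    IntegrableOn (fun s => F.field (v s) (γ s)) (Icc 0 1) := by
  refine Integrable.mono' ((integrableOn_norm_of_memLp hv).const_mul F.embConst) ?_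
    (Eventually.of_forall fun s => F.norm_field_le _ _)
  exact F.continuous_field.comp_aestronglyMeasurable
    (hv.1.prodMk (hγ.aestronglyMeasurable measurableSet_Icc))

theorem intervalIntegrable_of_integrableOn_unit {G : Type*} [NormedAddCommGroup G] {f : ℝ → G}
    (hf : IntegrableOn f (Icc 0 1)) {a b : ℝ} (ha : a ∈ Icc (0 : ℝ) 1) (hb : b ∈ Icc (0 : ℝ) 1) :
    IntervalIntegrable f volume a b :=
  (hf.mono_set (uIcc_subset_Icc ha hb)).intervalIntegrable

/-- The total strength `c ∫₀¹ ‖v_s‖ ds` of a time-dependent field. -/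
def flowConst (F : FieldSpace n V) (v : ℝ → V) : ℝ :=
  F.embConst * ∫ s in (0 : ℝ)..1, ‖v s‖

theorem flowConst_nonneg (F : FieldSpace n V) (v : ℝ → V) : 0 ≤ flowConst F v :=
  mul_nonneg F.embConst_pos.le
    (intervalIntegral.integral_nonneg zero_le_one fun _ _ => norm_nonneg _)

theorem integral_norm_le_flowConst (F : FieldSpace n V) {v : ℝ → V} (hv : MemLp v 2 unitTime)
    {a b : ℝ} (ha : 0 ≤ a) (hab : a ≤ b) (hb : b ≤ 1) :
    ∫ s in a..b, F.embConst * ‖v s‖ ≤ flowConst F v := by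
  rw [flowConst, ← intervalIntegral.integral_const_mul]
  exact intervalIntegral.integral_mono_interval ha hab hb
    (Eventually.of_forall fun s => mul_nonneg F.embConst_pos.le (norm_nonneg _))
    (intervalIntegrable_of_integrableOn_unit ((integrableOn_norm_of_memLp hv).const_mul _)
      (by simp) (by simp))

variable {F : FieldSpace n V} {v : ℝ → V} {φ : ℝ → E n → E n}

theorem IsFlow.sub_eq_integral (h : IsFlow F v φ) (hv : MemLp v 2 unitTime) {s t : ℝ}
    (hs : s ∈ Icc (0 : ℝ) 1) (ht : t ∈ Icc (0 : ℝ) 1) (x : E n) :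
    φ t x - φ s x = ∫ r in s..t, F.field (v r) (φ r x) := by
  have hi := integrableOn_field_comp F hv (h x).1
  have h0 : (0 : ℝ) ∈ Icc (0 : ℝ) 1 := by simp
  rw [(h x).2 t ht, (h x).2 s hs, add_sub_add_left_eq_sub,
    intervalIntegral.integral_interval_sub_left (intervalIntegrable_of_integrableOn_unit hi h0 ht)
      (intervalIntegrable_of_integrableOn_unit hi h0 hs)]

theorem IsFlow.apply_zero (h : IsFlow F v φ) (x : E n) : φ 0 x = x := by
  simpa using (h x).2 0 (by simp)

/-- Bounds for an integral of terms that are dominated by `c ‖v_s‖ w(s)`. -/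
theorem norm_integral_le_of_norm_le_mul (hv : MemLp v 2 unitTime) {f : ℝ → E n} {w : ℝ → ℝ}
    {s t : ℝ} (hs : 0 ≤ s) (hst : s ≤ t) (ht : t ≤ 1) (hw : ContinuousOn w (Icc 0 1))
    (hfw : ∀ r, ‖f r‖ ≤ F.embConst * ‖v r‖ * w r) :
    ‖∫ r in s..t, f r‖ ≤ ∫ r in s..t, F.embConst * ‖v r‖ * w r := by
  refine intervalIntegral.norm_integral_le_of_norm_le hst (Eventually.of_forall fun r _ => hfw r) ?_
  refine IntervalIntegrable.mul_continuousOn ?_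
    (hw.mono (uIcc_subset_Icc ⟨hs, hst.trans ht⟩ ⟨hs.trans hst, ht⟩))
  exact intervalIntegrable_of_integrableOn_unit ((integrableOn_norm_of_memLp hv).const_mul _)
    ⟨hs, hst.trans ht⟩ ⟨hs.trans hst, ht⟩

theorem IsFlow.norm_apply_sub_le (h : IsFlow F v φ) (hv : MemLp v 2 unitTime) {t : ℝ}
    (ht : t ∈ Icc (0 : ℝ) 1) (x : E n) : ‖φ t x - x‖ ≤ flowConst F v := by
  have h1 := h.sub_eq_integral hv (s := 0) (by simp) ht x
  rw [h.apply_zero] at h1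
  rw [h1]
  refine (norm_integral_le_of_norm_le_mul (F := F) hv le_rfl ht.1 ht.2
    (continuousOn_const (c := (1 : ℝ))) fun r => ?_).trans ?_
  · simpa using F.norm_field_le (v r) (φ r x)
  · simpa using integral_norm_le_flowConst F hv le_rfl ht.1 ht.2

theorem IsFlow.norm_sub_le_exp (h : IsFlow F v φ) (hv : MemLp v 2 unitTime) {t : ℝ}
    (ht : t ∈ Icc (0 : ℝ) 1) (x y : E n) :
    ‖φ t x - φ t y‖ ≤ Real.exp (flowConst F v) * ‖x - y‖ := by
  have hc : ContinuousOn (fun s => ‖φ s x - φ s y‖) (Icc 0 1) := ((h x).1.sub (h y).1).norm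
  have hsub : Icc 0 t ⊆ Icc (0 : ℝ) 1 := Icc_subset_Icc_right ht.2
  have h0 : (0 : ℝ) ∈ Icc (0 : ℝ) 1 := by simp
  have := le_mul_exp_of_le_add_integral (u := fun s => ‖φ s x - φ s y‖)
    (g := fun s => F.embConst * ‖v s‖) (C := ‖x - y‖) ht.1 (hc.mono hsub)
    (intervalIntegrable_of_integrableOn_unit ((integrableOn_norm_of_memLp hv).const_mul _) h0 ht)
    (fun s => mul_nonneg F.embConst_pos.le (norm_nonneg _)) (fun s hs => ?_)
  · refine this.trans ?_
    rw [mul_comm]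
    gcongr
    exact integral_norm_le_flowConst F hv le_rfl ht.1 ht.2
  · have hx := h.sub_eq_integral hv h0 (hsub hs) x
    have hy := h.sub_eq_integral hv h0 (hsub hs) y
    rw [h.apply_zero] at hx hy
    have e : φ s x - φ s y = (x - y) +
        ∫ r in (0 : ℝ)..s, (F.field (v r) (φ r x) - F.field (v r) (φ r y)) := by
      rw [intervalIntegral.integral_sub
        (intervalIntegrable_of_integrableOn_unit (integrableOn_field_comp F hv (h x).1) h0 (hsub hs))
        (intervalIntegrable_of_integrableOn_unit (integrableOn_field_comp F hv (h y).1) h0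
          (hsub hs)), ← hx, ← hy]
      abel
    rw [e]
    refine (norm_add_le _ _).trans (add_le_add_right ?_ _)
    exact norm_integral_le_of_norm_le_mul hv le_rfl hs.1 (hs.2.trans ht.2) hc
      fun r => F.norm_field_sub_le _ _ _

/-- A flow is expanding up to a constant, by Grönwall's inequality run backwards from time `t`. -/
theorem IsFlow.norm_sub_le_exp' (h : IsFlow F v φ) (hv : MemLp v 2 unitTime) {t : ℝ}
    (ht : t ∈ Icc (0 : ℝ) 1) (x y : E n) :
    ‖x - y‖ ≤ Real.exp (flowConst F v) * ‖φ t x - φ t y‖ := by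
  have hc : ContinuousOn (fun s => ‖φ s x - φ s y‖) (Icc 0 1) := ((h x).1.sub (h y).1).norm
  have hmap : MapsTo (fun s => t - s) (Icc 0 t) (Icc (0 : ℝ) 1) := fun s hs =>
    ⟨by linarith [hs.2], by linarith [hs.1, ht.2]⟩
  have h0 : (0 : ℝ) ∈ Icc (0 : ℝ) 1 := by simp
  have hgi : IntervalIntegrable (fun s => F.embConst * ‖v s‖) volume 0 t :=
    intervalIntegrable_of_integrableOn_unit ((integrableOn_norm_of_memLp hv).const_mul _) h0 ht
  have := le_mul_exp_of_le_add_integral (u := fun s => ‖φ (t - s) x - φ (t - s) y‖)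
    (g := fun s => F.embConst * ‖v (t - s)‖) (C := ‖φ t x - φ t y‖) ht.1
    (hc.comp (by fun_prop) hmap) (by simpa using (hgi.comp_sub_left t).symm)
    (fun s => mul_nonneg F.embConst_pos.le (norm_nonneg _)) (fun s hs => ?_)
  · simp only [sub_self, h.apply_zero] at this
    refine this.trans ?_
    rw [mul_comm]
    gcongr
    rw [intervalIntegral.integral_comp_sub_left (fun s => F.embConst * ‖v s‖) t]
    simpa using integral_norm_le_flowConst F hv le_rfl ht.1 ht.2
  · have hx := h.sub_eq_integral hv (hmap hs) ht x
    have hy := h.sub_eq_integral hv (hmap hs) ht y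
    have e : φ (t - s) x - φ (t - s) y = (φ t x - φ t y) -
        ∫ r in (t - s)..t, (F.field (v r) (φ r x) - F.field (v r) (φ r y)) := by
      rw [intervalIntegral.integral_sub
        (intervalIntegrable_of_integrableOn_unit (integrableOn_field_comp F hv (h x).1) (hmap hs) ht)
        (intervalIntegrable_of_integrableOn_unit (integrableOn_field_comp F hv (h y).1) (hmap hs)
          ht), ← hx, ← hy]
      abel
    rw [e]
    refine (norm_sub_le _ _).trans (add_le_add_right ?_ _)
    refine (norm_integral_le_of_norm_le_mul (w := fun r => ‖φ r x - φ r y‖) hv (hmap hs).1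
      (by linarith [hs.1]) ht.2 hc fun r => F.norm_field_sub_le _ _ _).trans_eq ?_
    rw [intervalIntegral.integral_comp_sub_left
      (fun r => F.embConst * ‖v r‖ * ‖φ r x - φ r y‖) t, sub_zero]

/-- Unlike the Lipschitz bound for `φ t`, this constant tends to `0` with `flowConst`. It forces the
derivatives to the identity when the energy vanishes. -/
theorem IsFlow.norm_displacement_sub_le (h : IsFlow F v φ) (hv : MemLp v 2 unitTime) {t : ℝ}
    (ht : t ∈ Icc (0 : ℝ) 1) (x y : E n) :
    ‖(φ t x - x) - (φ t y - y)‖ ≤ flowConst F v * Real.exp (flowConst F v) * ‖x - y‖ := by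
  have hc : ContinuousOn (fun s => ‖φ s x - φ s y‖) (Icc 0 1) := ((h x).1.sub (h y).1).norm
  have h0 : (0 : ℝ) ∈ Icc (0 : ℝ) 1 := by simp
  have hx := h.sub_eq_integral hv h0 ht x
  have hy := h.sub_eq_integral hv h0 ht y
  rw [h.apply_zero] at hx hy
  rw [hx, hy, ← intervalIntegral.integral_sub
        (intervalIntegrable_of_integrableOn_unit (integrableOn_field_comp F hv (h x).1) h0 ht)
        (intervalIntegrable_of_integrableOn_unit (integrableOn_field_comp F hv (h y).1) h0 ht)]
  refine (norm_integral_le_of_norm_le_mul hv le_rfl ht.1 ht.2 hc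
    fun r => F.norm_field_sub_le _ _ _).trans ?_
  have hgi : IntervalIntegrable (fun s => F.embConst * ‖v s‖) volume 0 t :=
    intervalIntegrable_of_integrableOn_unit ((integrableOn_norm_of_memLp hv).const_mul _) h0 ht
  calc _ ≤ ∫ r in (0 : ℝ)..t, F.embConst * ‖v r‖ * (Real.exp (flowConst F v) * ‖x - y‖) := by
        refine intervalIntegral.integral_mono_on ht.1 (hgi.mul_continuousOn
          (hc.mono (uIcc_subset_Icc h0 ht))) (hgi.mul_const _) fun r hr => ?_
        exact mul_le_mul_of_nonneg_left
          (h.norm_sub_le_exp hv (Icc_subset_Icc_right ht.2 hr) x y)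
          (mul_nonneg F.embConst_pos.le (norm_nonneg _))
    _ = (∫ r in (0 : ℝ)..t, F.embConst * ‖v r‖) * (Real.exp (flowConst F v) * ‖x - y‖) :=
        intervalIntegral.integral_mul_const _ _
    _ ≤ flowConst F v * (Real.exp (flowConst F v) * ‖x - y‖) := by
        gcongr
        exact integral_norm_le_flowConst F hv le_rfl ht.1 ht.2
    _ = _ := by ring

/-- Grönwall's inequality for the second difference `D` of trajectories. The two Lipschitz factors
in the source term give `K ^ 2`, and the Grönwall exponential gives the third `K`. -/
theorem IsFlow.norm_secondDiff_le (h : IsFlow F v φ) (hv : MemLp v 2 unitTime) {t : ℝ}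
    (ht : t ∈ Icc (0 : ℝ) 1) (x p q : E n) :
    ‖φ t (x + p + q) - φ t (x + p) - φ t (x + q) + φ t x‖ ≤
      flowConst F v * Real.exp (flowConst F v) ^ 3 * ‖p‖ * ‖q‖ := by
  set K := Real.exp (flowConst F v) with hK
  have h0 : (0 : ℝ) ∈ Icc (0 : ℝ) 1 := by simp
  set D : ℝ → E n := fun s => φ s (x + p + q) - φ s (x + p) - φ s (x + q) + φ s x with hD
  have hDc : ContinuousOn D (Icc 0 1) :=
    (((h _).1.sub (h _).1).sub (h _).1).add (h _).1
  have hsub : Icc 0 t ⊆ Icc (0 : ℝ) 1 := Icc_subset_Icc_right ht.2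
  have hgi : ∀ s ∈ Icc (0 : ℝ) 1, IntervalIntegrable (fun s => F.embConst * ‖v s‖) volume 0 s :=
    fun s hs => intervalIntegrable_of_integrableOn_unit
      ((integrableOn_norm_of_memLp hv).const_mul _) h0 hs
  have := le_mul_exp_of_le_add_integral (u := fun s => ‖D s‖)
    (g := fun s => F.embConst * ‖v s‖) (C := flowConst F v * (K ^ 2 * ‖p‖ * ‖q‖)) ht.1
    (hDc.norm.mono hsub) (hgi t ht)
    (fun s => mul_nonneg F.embConst_pos.le (norm_nonneg _)) (fun s hs => ?_)
  · refine this.trans ?_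
    have : Real.exp (∫ s in (0 : ℝ)..t, F.embConst * ‖v s‖) ≤ K :=
      Real.exp_le_exp.2 (integral_norm_le_flowConst F hv le_rfl ht.1 ht.2)
    have hκ := flowConst_nonneg F v
    calc _ ≤ flowConst F v * (K ^ 2 * ‖p‖ * ‖q‖) * K := by gcongr
      _ = _ := by ring
  · have hs' := hsub hs
    have hI : ∀ z, IntervalIntegrable (fun r => F.field (v r) (φ r z)) volume 0 s := fun z =>
      intervalIntegrable_of_integrableOn_unit (integrableOn_field_comp F hv (h z).1) h0 hs'
    have hz : ∀ z, φ s z = z + ∫ r in (0 : ℝ)..s, F.field (v r) (φ r z) := fun z => (h z).2 s hs'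
    have e : D s = ∫ r in (0 : ℝ)..s, (F.field (v r) (φ r (x + p + q)) -
        F.field (v r) (φ r (x + p)) - F.field (v r) (φ r (x + q)) + F.field (v r) (φ r x)) := by
      rw [intervalIntegral.integral_add (((hI _).sub (hI _)).sub (hI _)) (hI _),
        intervalIntegral.integral_sub ((hI _).sub (hI _)) (hI _),
        intervalIntegral.integral_sub (hI _) (hI _)]
      change φ s (x + p + q) - φ s (x + p) - φ s (x + q) + φ s x = _
      rw [hz (x + p + q), hz (x + p), hz (x + q), hz x]
      abel
    rw [e]
    refine (intervalIntegral.norm_integral_le_of_norm_le hs.1 (g := fun r =>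
      F.embConst * ‖v r‖ * (K ^ 2 * ‖p‖ * ‖q‖) + F.embConst * ‖v r‖ * ‖D r‖)
      (Eventually.of_forall fun r hr => ?_) ?_).trans ?_
    · have hr' : r ∈ Icc (0 : ℝ) 1 := hsub ⟨hr.1.le, hr.2.trans hs.2⟩
      -- Compare the fourth trajectory with `b + (c - a)`, the fourth vertex of the parallelogram on
      -- `a`, `b`, `c`. The field's second difference on the parallelogram is the source term, and
      -- the discrepancy between the two points is `D r`.
      set a := φ r x
      set b := φ r (x + p)
      set c := φ r (x + q)
      have h1 := F.norm_field_sub_le (v r) (φ r (x + p + q)) (a + (b - a) + (c - a))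
      have h2 := F.norm_field_secondDiff_le (v r) a (b - a) (c - a)
      have h3 : ‖b - a‖ ≤ K * ‖p‖ := by simpa using h.norm_sub_le_exp hv hr' (x + p) x
      have h4 : ‖c - a‖ ≤ K * ‖q‖ := by simpa using h.norm_sub_le_exp hv hr' (x + q) x
      have h5 : φ r (x + p + q) - (a + (b - a) + (c - a)) = D r := by
        simp only [hD]; abel
      rw [h5] at h1
      rw [add_sub_cancel a b, add_sub_cancel a c] at h2
      rw [add_sub_cancel a b] at h1
      have hcv : 0 ≤ F.embConst * ‖v r‖ := mul_nonneg F.embConst_pos.le (norm_nonneg _)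
      calc _ = ‖(F.field (v r) (b + (c - a)) - F.field (v r) b - F.field (v r) c
              + F.field (v r) a) + (F.field (v r) (φ r (x + p + q))
              - F.field (v r) (b + (c - a)))‖ := by congr 1; abel
        _ ≤ _ := norm_add_le _ _
        _ ≤ F.embConst * ‖v r‖ * ‖b - a‖ * ‖c - a‖ + F.embConst * ‖v r‖ * ‖D r‖ :=
            add_le_add h2 h1
        _ ≤ F.embConst * ‖v r‖ * (K * ‖p‖) * (K * ‖q‖) + F.embConst * ‖v r‖ * ‖D r‖ := by
            gcongr
        _ = _ := by ring
    · exact ((hgi s hs').mul_const _).add ((hgi s hs').mul_continuousOn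
        (hDc.norm.mono (uIcc_subset_Icc h0 hs')))
    · rw [intervalIntegral.integral_add ((hgi s hs').mul_const _)
        ((hgi s hs').mul_continuousOn (hDc.norm.mono (uIcc_subset_Icc h0 hs'))),
        intervalIntegral.integral_mul_const]
      gcongr
      exact integral_norm_le_flowConst F hv le_rfl hs.1 hs'.2

end Flow

/-- A `C¹`-diffeomorphism of `ℝⁿ`: a homeomorphism of class `C¹` with injective derivatives. -/
structure IsDiffeo {n : ℕ} (f : E n → E n) : Prop where
  contDiff : ContDiff ℝ 1 f
  isHomeomorph : IsHomeomorph f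
  injective_fderiv : ∀ x, Function.Injective (fderiv ℝ f x)

/-- Surjectivity is topological: the inverse function theorem makes the range open, the expanding
bound makes it closed, and the space is connected. -/
theorem isDiffeo_of_bounds {n : ℕ} {f : E n → E n} {L K C : ℝ} (hK0 : 0 ≤ K)
    (hL : ∀ x y, ‖f x - f y‖ ≤ L * ‖x - y‖)
    (hK : ∀ x y, ‖x - y‖ ≤ K * ‖f x - f y‖)
    (hC : ∀ x p q, ‖f (x + p + q) - f (x + p) - f (x + q) + f x‖ ≤ C * ‖p‖ * ‖q‖) :
    IsDiffeo f := by
  have hcd := contDiff_one_of_secondDiff_le hL hC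
  have hdiff : Differentiable ℝ f := hcd.differentiable one_ne_zero
  have hinj : ∀ x, Function.Injective (fderiv ℝ f x) := by
    intro x
    rw [injective_iff_map_eq_zero]
    intro e he
    have := norm_le_mul_norm_fderiv_apply hK (hdiff x) e
    rw [he, norm_zero, mul_zero] at this
    exact norm_le_zero_iff.1 this
  have hopen : IsOpenMap f := by
    refine isOpenMap_of_hasStrictFDerivAt_equiv (f' := fun x =>
      (LinearEquiv.ofInjectiveEndo _ (hinj x)).toContinuousLinearEquiv) fun x => ?_
    convert hcd.contDiffAt.hasStrictFDerivAt one_ne_zero using 1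
    ext1 e
    rfl
  have hanti : AntilipschitzWith K.toNNReal f := AntilipschitzWith.of_le_mul_dist fun x y => by
    rw [dist_eq_norm, dist_eq_norm, Real.coe_toNNReal _ hK0]
    exact hK x y
  have hlip : LipschitzWith L.toNNReal f := LipschitzWith.of_dist_le' fun x y => by
    rw [dist_eq_norm, dist_eq_norm]
    exact hL x y
  have hrange : range f = univ := IsClopen.eq_univ
    ⟨hanti.isClosed_range hlip.uniformContinuous, hopen.isOpen_range⟩ (range_nonempty f)
  exact ⟨hcd, ⟨hcd.continuous, hopen, hanti.injective, range_eq_univ.1 hrange⟩, hinj⟩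

section Flow

variable {n : ℕ} {V : Type*} [NormedAddCommGroup V] [InnerProductSpace ℝ V]
  {F : FieldSpace n V} {v : ℝ → V} {φ : ℝ → E n → E n}

theorem IsFlow.isDiffeo (h : IsFlow F v φ) (hv : MemLp v 2 unitTime) {t : ℝ}
    (ht : t ∈ Icc (0 : ℝ) 1) : IsDiffeo (φ t) :=
  isDiffeo_of_bounds (Real.exp_nonneg _) (h.norm_sub_le_exp hv ht) (h.norm_sub_le_exp' hv ht)
    (h.norm_secondDiff_le hv ht)

theorem IsFlow.norm_fderiv_apply_le (h : IsFlow F v φ) (hv : MemLp v 2 unitTime) {t : ℝ}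
    (ht : t ∈ Icc (0 : ℝ) 1) (x e : E n) :
    ‖fderiv ℝ (φ t) x e‖ ≤ Real.exp (flowConst F v) * ‖e‖ := by
  have hlip : LipschitzWith (Real.exp (flowConst F v)).toNNReal (φ t) :=
    LipschitzWith.of_dist_le' fun x y => by
      rw [dist_eq_norm, dist_eq_norm]
      exact h.norm_sub_le_exp hv ht x y
  refine (ContinuousLinearMap.le_opNorm _ _).trans ?_
  gcongr
  simpa [Real.exp_nonneg] using norm_fderiv_le_of_lipschitz ℝ hlip (x₀ := x)

theorem IsFlow.norm_le_norm_fderiv_apply (h : IsFlow F v φ) (hv : MemLp v 2 unitTime) {t : ℝ}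
    (ht : t ∈ Icc (0 : ℝ) 1) (x e : E n) :
    ‖e‖ ≤ Real.exp (flowConst F v) * ‖fderiv ℝ (φ t) x e‖ :=
  norm_le_mul_norm_fderiv_apply (h.norm_sub_le_exp' hv ht)
    ((h.isDiffeo hv ht).contDiff.differentiable one_ne_zero x) e

theorem IsFlow.norm_fderiv_sub_id_le (h : IsFlow F v φ) (hv : MemLp v 2 unitTime) {t : ℝ}
    (ht : t ∈ Icc (0 : ℝ) 1) (x : E n) :
    ‖fderiv ℝ (φ t) x - ContinuousLinearMap.id ℝ (E n)‖ ≤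
      flowConst F v * Real.exp (flowConst F v) := by
  have hnn : 0 ≤ flowConst F v * Real.exp (flowConst F v) :=
    mul_nonneg (flowConst_nonneg F v) (Real.exp_nonneg _)
  have hlip : LipschitzWith (flowConst F v * Real.exp (flowConst F v)).toNNReal
      (fun z => φ t z - z) :=
    LipschitzWith.of_dist_le' fun x y => by
      rw [dist_eq_norm, dist_eq_norm]
      exact h.norm_displacement_sub_le hv ht x y
  have h1 := norm_fderiv_le_of_lipschitz ℝ hlip (x₀ := x)
  have hd := (h.isDiffeo hv ht).contDiff.differentiable one_ne_zero x
  have h2 : HasFDerivAt (fun z => φ t z - z)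
      (fderiv ℝ (φ t) x - ContinuousLinearMap.id ℝ (E n)) x :=
    hd.hasFDerivAt.fun_sub (hasFDerivAt_id x)
  rwa [Real.coe_toNNReal _ hnn, h2.fderiv] at h1

end Flow

/-! ### The oriented Grassmannian -/

section Grassmannian

variable {n d : ℕ}

theorem linearIndependent_iff_frameVolume_ne_zero {u : Fin d → E n} :
    LinearIndependent ℝ u ↔ frameVolume u ≠ 0 := by
  have h := Matrix.posSemidef_gram ℝ u
  rw [frameVolume, Real.sqrt_ne_zero h.det_nonneg, ← h.posDef_iff_det_ne_zero,
    Matrix.posDef_gram_iff_linearIndependent]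

theorem frameVolume_pos {u : Fin d → E n} (hu : LinearIndependent ℝ u) : 0 < frameVolume u :=
  lt_of_le_of_ne (Real.sqrt_nonneg _) (linearIndependent_iff_frameVolume_ne_zero.1 hu).symm

theorem continuous_frameVolume : Continuous (frameVolume : (Fin d → E n) → ℝ) := by
  refine Real.continuous_sqrt.comp (Continuous.matrix_det ?_)
  refine continuous_matrix fun i j => ?_
  simp only [Matrix.gram_apply]
  fun_prop

/-- The oriented subspace spanned by a frame. -/
def orientedSpan (u : Frame n d) : OrientedGrassmannian n d := Quotient.mk (frameSetoid n d) u

/-- The frame with vectors `∑ j, A i j • u j`. -/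
def frameAct (A : Matrix (Fin d) (Fin d) ℝ) (hA : 0 < A.det) (u : Frame n d) : Frame n d :=
  ⟨fun i => ∑ j, A i j • u.1 j, by
    rw [linearIndependent_iff_frameVolume_ne_zero, frameVolume_comp fun _ => rfl]
    exact mul_ne_zero (abs_ne_zero.2 hA.ne') (frameVolume_pos u.2).ne'⟩

theorem continuous_frameAct (A : Matrix (Fin d) (Fin d) ℝ) (hA : 0 < A.det) :
    Continuous (frameAct (n := n) A hA) := by
  refine Continuous.subtype_mk (continuous_pi fun i => ?_) _
  exact continuous_finsetSum _ fun j _ =>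
    ((continuous_apply j).comp continuous_subtype_val).const_smul (A i j)

/-- The saturation of an open set of frames is a union of its preimages under the continuous maps
`frameAct A`. Openness matters because an open quotient map stays a quotient map after taking the
product with an identity, so joint continuity of `transport` and `jacobian` can be checked on
frames. -/
theorem isOpenQuotientMap_orientedSpan :
    IsOpenQuotientMap (orientedSpan : Frame n d → OrientedGrassmannian n d) := by
  refine ⟨Quotient.mk_surjective, continuous_quot_mk, fun O hO => ?_⟩
  have hset : orientedSpan ⁻¹' (orientedSpan '' O) =
      ⋃ (A : Matrix (Fin d) (Fin d) ℝ) (hA : 0 < A.det), frameAct A hA ⁻¹' O := by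
    ext w
    simp only [mem_preimage, mem_image, mem_iUnion]
    constructor
    · rintro ⟨u, hu, huw⟩
      obtain ⟨A, hA, h⟩ := Quotient.exact huw.symm
      refine ⟨A, hA, ?_⟩
      have : frameAct A hA w = u := Subtype.ext (funext fun i => (h i).symm)
      rwa [this]
    · rintro ⟨A, hA, h⟩
      exact ⟨_, h, (Quotient.sound ⟨A, hA, fun i => rfl⟩ :
        orientedSpan w = orientedSpan (frameAct A hA w)).symm⟩
  change IsOpen (orientedSpan ⁻¹' (orientedSpan '' O))
  rw [hset]
  exact isOpen_iUnion fun A => isOpen_iUnion fun hA => hO.preimage (continuous_frameAct A hA)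

theorem orientedSpan_surjective :
    Function.Surjective (orientedSpan : Frame n d → OrientedGrassmannian n d) :=
  isOpenQuotientMap_orientedSpan.surjective

/-- The image of a frame under an injective linear map. -/
def mapFrame (L : E n →L[ℝ] E n) (hL : Function.Injective L) (u : Frame n d) : Frame n d :=
  ⟨fun i => L (u.1 i), u.2.map' (L : E n →ₗ[ℝ] E n) (LinearMap.ker_eq_bot.mpr hL)⟩

theorem transport_orientedSpan {L : E n →L[ℝ] E n} (hL : Function.Injective L) (u : Frame n d) :
    transport L (orientedSpan u) = orientedSpan (mapFrame L hL u) := by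
  exact dif_pos hL

theorem jacobian_orientedSpan (L : E n →L[ℝ] E n) (u : Frame n d) :
    jacobian L (orientedSpan u) = frameVolume (fun i => L (u.1 i)) / frameVolume u.1 := rfl

theorem jacobian_pos {L : E n →L[ℝ] E n} (hL : Function.Injective L)
    (U : OrientedGrassmannian n d) : 0 < jacobian L U := by
  obtain ⟨u, rfl⟩ := orientedSpan_surjective U
  exact div_pos (frameVolume_pos (mapFrame L hL u).2) (frameVolume_pos u.2)

theorem transport_comp {L M : E n →L[ℝ] E n} (hL : Function.Injective L)
    (hM : Function.Injective M) (U : OrientedGrassmannian n d) :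
    transport (M.comp L) U = transport M (transport L U) := by
  obtain ⟨u, rfl⟩ := orientedSpan_surjective U
  have hML : Function.Injective (M.comp L) := hM.comp hL
  rw [transport_orientedSpan hL, transport_orientedSpan hM, transport_orientedSpan hML]
  rfl

theorem jacobian_comp {L M : E n →L[ℝ] E n} (hL : Function.Injective L)
    (U : OrientedGrassmannian n d) :
    jacobian (M.comp L) U = jacobian M (transport L U) * jacobian L U := by
  obtain ⟨u, rfl⟩ := orientedSpan_surjective U
  rw [transport_orientedSpan hL, jacobian_orientedSpan, jacobian_orientedSpan,
    jacobian_orientedSpan]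
  exact (div_mul_div_cancel₀ (frameVolume_pos (mapFrame L hL u).2).ne').symm

theorem transport_id (U : OrientedGrassmannian n d) :
    transport (ContinuousLinearMap.id ℝ (E n)) U = U := by
  obtain ⟨u, rfl⟩ := orientedSpan_surjective U
  rw [transport_orientedSpan fun _ _ h => h]
  rfl

theorem jacobian_id (U : OrientedGrassmannian n d) :
    jacobian (ContinuousLinearMap.id ℝ (E n)) U = 1 := by
  obtain ⟨u, rfl⟩ := orientedSpan_surjective U
  exact div_self (frameVolume_pos u.2).ne'

theorem continuous_apply_frame {X : Type*} [TopologicalSpace X] {L : X → E n →L[ℝ] E n}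
    (hL : Continuous L) : Continuous fun p : X × Frame n d => fun i => L p.1 (p.2.1 i) :=
  continuous_pi fun i => (hL.comp continuous_fst).clm_apply
    ((continuous_apply i).comp (continuous_subtype_val.comp continuous_snd))

theorem continuous_transport {X : Type*} [TopologicalSpace X] {L : X → E n →L[ℝ] E n}
    (hL : Continuous L) (hinj : ∀ x, Function.Injective (L x)) :
    Continuous fun p : X × OrientedGrassmannian n d => transport (L p.1) p.2 := by
  have hq := (IsOpenQuotientMap.id (X := X)).prodMap
    (isOpenQuotientMap_orientedSpan (n := n) (d := d))
  rw [hq.isQuotientMap.continuous_iff]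
  have : (fun p : X × OrientedGrassmannian n d => transport (L p.1) p.2) ∘
      Prod.map id orientedSpan =
      fun p : X × Frame n d => orientedSpan (mapFrame (L p.1) (hinj p.1) p.2) :=
    funext fun p => transport_orientedSpan (hinj p.1) p.2
  rw [this]
  refine isOpenQuotientMap_orientedSpan.continuous.comp 
    (Continuous.subtype_mk (continuous_apply_frame hL) _)

theorem continuous_jacobian {X : Type*} [TopologicalSpace X] {L : X → E n →L[ℝ] E n}
    (hL : Continuous L) :
    Continuous fun p : X × OrientedGrassmannian n d => jacobian (L p.1) p.2 := by
  have hq := (IsOpenQuotientMap.id (X := X)).prodMap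
    (isOpenQuotientMap_orientedSpan (n := n) (d := d))
  rw [hq.isQuotientMap.continuous_iff]
  change Continuous fun p : X × Frame n d =>
    frameVolume (fun i => L p.1 (p.2.1 i)) / frameVolume p.2.1
  refine Continuous.div (continuous_frameVolume.comp (continuous_apply_frame hL))
    (continuous_frameVolume.comp (continuous_subtype_val.comp continuous_snd)) fun p => (frameVolume_pos p.2.2).ne'

theorem tendsto_transport_id {ι : Type*} {l : Filter ι} {L : ι → E n →L[ℝ] E n}
    (hL : Tendsto L l (𝓝 (ContinuousLinearMap.id ℝ (E n))))
    (hinj : ∀ i, Function.Injective (L i)) (U : OrientedGrassmannian n d) :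
    Tendsto (fun i => transport (L i) U) l (𝓝 U) := by
  obtain ⟨u, rfl⟩ := orientedSpan_surjective U
  simp only [transport_orientedSpan (hinj _)]
  refine (isOpenQuotientMap_orientedSpan.continuous.tendsto u).comp ?_
  refine tendsto_subtype_rng.2 (tendsto_pi_nhds.2 fun j => ?_)
  exact (((ContinuousLinearMap.apply ℝ (E n) (u.1 j)).continuous.tendsto _).comp hL)

theorem tendsto_jacobian_id {ι : Type*} {l : Filter ι} {L : ι → E n →L[ℝ] E n}
    (hL : Tendsto L l (𝓝 (ContinuousLinearMap.id ℝ (E n)))) (U : OrientedGrassmannian n d) :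
    Tendsto (fun i => jacobian (L i) U) l (𝓝 1) := by
  obtain ⟨u, rfl⟩ := orientedSpan_surjective U
  simp only [jacobian_orientedSpan]
  rw [← div_self (frameVolume_pos u.2).ne']
  refine Tendsto.div_const ?_ _
  refine (continuous_frameVolume.tendsto u.1).comp (tendsto_pi_nhds.2 fun j => ?_)
  exact ((ContinuousLinearMap.apply ℝ (E n) (u.1 j)).continuous.tendsto _).comp hL

/-- The sign of `A.det` is not controlled, so `w` may have the opposite orientation. This is
harmless for Jacobians, which see only `|A.det|`. -/
theorem exists_orthonormal_comp (u : Frame n d) :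
    ∃ (w : Fin d → E n) (A : Matrix (Fin d) (Fin d) ℝ), Orthonormal ℝ w ∧
      ∀ i, w i = ∑ j, A i j • u.1 j := by
  set S := Submodule.span ℝ (range u.1)
  have hS : Module.finrank ℝ S = d := by simpa using finrank_span_eq_card u.2
  let b := (stdOrthonormalBasis ℝ S).reindex (finCongr hS)
  have hb : ∀ i, ∃ c : Fin d → ℝ, ∑ j, c j • u.1 j = (b i : E n) := fun i =>
    (Submodule.mem_span_range_iff_exists_fun ℝ).1 (b i).2
  choose A hA using hb
  exact ⟨fun i => b i, A, b.orthonormal.comp_linearIsometry S.subtypeₗᵢ, fun i => (hA i).symm⟩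

theorem frameVolume_of_orthonormal {w : Fin d → E n} (hw : Orthonormal ℝ w) :
    frameVolume w = 1 := by
  have : Matrix.gram ℝ w = 1 := by
    ext i j
    rw [Matrix.gram_apply, orthonormal_iff_ite.1 hw, Matrix.one_apply]
  rw [frameVolume, this, Matrix.det_one, Real.sqrt_one]

/-- An upper bound for the Jacobian of a linear map of norm at most `K`. -/
def jacobianBound (d : ℕ) (K : ℝ) : ℝ := Real.sqrt (d.factorial * (K ^ 2) ^ d)

/-- On an orthonormal frame the Gram matrix of the image has entries of size at most `K ^ 2`, and
the Leibniz expansion has `d!` terms. The bound is crude, but uniform in `U`. -/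
theorem jacobian_le {L : E n →L[ℝ] E n} {K : ℝ} (hL : ∀ e, ‖L e‖ ≤ K * ‖e‖)
    (U : OrientedGrassmannian n d) : jacobian L U ≤ jacobianBound d K := by
  obtain ⟨u, rfl⟩ := orientedSpan_surjective U
  obtain ⟨w, A, hw, hA⟩ := exists_orthonormal_comp u
  have h1 := frameVolume_comp hA
  rw [frameVolume_of_orthonormal hw] at h1
  have h2 := frameVolume_comp (A := A) (u := fun j => L (u.1 j)) (w := fun i => L (w i))
    fun i => by simp [hA i]
  have hj : jacobian L (orientedSpan u) = frameVolume fun i => L (w i) := by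
    rw [jacobian_orientedSpan, h2, div_eq_iff (frameVolume_pos u.2).ne']
    linear_combination (frameVolume fun i => L (u.1 i)) * h1
  rw [hj]
  refine Real.sqrt_le_sqrt ((le_abs_self _).trans ?_)
  have := Matrix.det_le (A := Matrix.gram ℝ fun i => L (w i)) (abv := AbsoluteValue.abs)
    (x := K ^ 2) fun i j => ?_
  · simpa [nsmul_eq_mul] using this
  · rw [Matrix.gram_apply]
    refine (abs_real_inner_le_norm _ _).trans ?_
    have hi := hL (w i)
    have hj := hL (w j)
    rw [hw.1, mul_one] at hi hj
    have := mul_le_mul hi hj (norm_nonneg _) ((norm_nonneg _).trans hi)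
    rwa [← sq] at this

/-- The upper bound applied to the inverse map, together with multiplicativity of the Jacobian. -/
theorem one_le_jacobianBound_mul {L : E n →L[ℝ] E n} {K : ℝ} (hL : ∀ e, ‖e‖ ≤ K * ‖L e‖)
    (U : OrientedGrassmannian n d) : 1 ≤ jacobianBound d K * jacobian L U := by
  have hinj : Function.Injective L := by
    rw [injective_iff_map_eq_zero]
    intro e he
    have := hL e
    rw [he, norm_zero, mul_zero] at this
    exact norm_le_zero_iff.1 this
  let e := (LinearEquiv.ofInjectiveEndo (L : E n →ₗ[ℝ] E n) hinj).toContinuousLinearEquiv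
  have he : ∀ x, e x = L x := fun x => rfl
  have hcomp : (e.symm : E n →L[ℝ] E n).comp L = ContinuousLinearMap.id ℝ (E n) := by
    ext1 x
    simp [← he]
  have h1 := jacobian_comp (M := (e.symm : E n →L[ℝ] E n)) hinj U
  rw [hcomp, jacobian_id] at h1
  rw [h1]
  refine mul_le_mul_of_nonneg_right (jacobian_le (fun y => ?_) _) (jacobian_pos hinj U).le
  have := hL (e.symm y)
  rwa [← he, e.apply_symm_apply] at this

end Grassmannian

/-! ### Pushforward and rescaling of varifolds -/

theorem map_withDensity_comp {α β : Type*} [MeasurableSpace α] [MeasurableSpace β]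
    {m : Measure α} {T : α → β} (hT : Measurable T) {g : β → ℝ≥0∞}
    (hg : AEMeasurable g (m.map T)) :
    (m.withDensity fun p => g (T p)).map T = (m.map T).withDensity g := by
  ext s hs
  rw [Measure.map_apply hT hs, withDensity_apply _ (hT hs), withDensity_apply _ hs,
    Measure.restrict_map hT hs, lintegral_map' ?_ hT.aemeasurable]
  rw [← Measure.restrict_map hT hs]
  exact hg.restrict

section Pushforward

variable {n d : ℕ} {φ ψ : E n → E n}

theorem IsDiffeo.differentiable (hφ : IsDiffeo φ) : Differentiable ℝ φ :=
  hφ.contDiff.differentiable one_ne_zero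

theorem IsDiffeo.fderiv_comp (hψ : IsDiffeo ψ) (hφ : IsDiffeo φ) (x : E n) :
    fderiv ℝ (ψ ∘ φ) x = (fderiv ℝ ψ (φ x)).comp (fderiv ℝ φ x) :=
  _root_.fderiv_comp x (hψ.differentiable _) (hφ.differentiable _)

theorem IsDiffeo.comp (hψ : IsDiffeo ψ) (hφ : IsDiffeo φ) : IsDiffeo (ψ ∘ φ) where
  contDiff := hψ.contDiff.comp hφ.contDiff
  isHomeomorph := hψ.isHomeomorph.comp hφ.isHomeomorph
  injective_fderiv x := by
    rw [hψ.fderiv_comp hφ]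
    exact (hψ.injective_fderiv _).comp (hφ.injective_fderiv _)

theorem IsDiffeo.measurableEmbedding (hφ : IsDiffeo φ) : MeasurableEmbedding φ :=
  hφ.isHomeomorph.isClosedEmbedding.measurableEmbedding

theorem IsDiffeo.invFun_apply (hφ : IsDiffeo φ) (x : E n) : Function.invFun φ (φ x) = x :=
  Function.leftInverse_invFun hφ.isHomeomorph.injective x

theorem IsDiffeo.apply_invFun (hφ : IsDiffeo φ) (x : E n) : φ (Function.invFun φ x) = x :=
  Function.rightInverse_invFun hφ.isHomeomorph.surjective x

theorem IsDiffeo.invFun_comp (hψ : IsDiffeo ψ) (hφ : IsDiffeo φ) (y : E n) :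
    Function.invFun (ψ ∘ φ) y = Function.invFun φ (Function.invFun ψ y) := by
  obtain ⟨x, rfl⟩ := (hψ.comp hφ).isHomeomorph.surjective y
  rw [(hψ.comp hφ).invFun_apply, Function.comp_apply, hψ.invFun_apply, hφ.invFun_apply]

/-- The action `(x, U) ↦ (φ x, d_xφ · U)` of a diffeomorphism on oriented planes. -/
def pushMap (φ : E n → E n) (p : E n × OrientedGrassmannian n d) :
    E n × OrientedGrassmannian n d :=
  (φ p.1, transport (fderiv ℝ φ p.1) p.2)

/-- The Jacobian of a diffeomorphism along oriented planes, as an extended nonnegative real. -/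
def pushDensity (φ : E n → E n) (p : E n × OrientedGrassmannian n d) : ℝ≥0∞ :=
  ENNReal.ofReal (jacobian (fderiv ℝ φ p.1) p.2)

theorem pushforward_eq (φ : E n → E n) (μ : Measure (E n × OrientedGrassmannian n d)) :
    pushforward φ μ = (μ.withDensity (pushDensity φ)).map (pushMap φ) := rfl

theorem IsDiffeo.measurable_pushMap (hφ : IsDiffeo φ) :
    Measurable (pushMap φ : E n × OrientedGrassmannian n d → _) :=
  (hφ.contDiff.continuous.measurable.comp measurable_fst).prodMk
    (continuous_transport (hφ.contDiff.continuous_fderiv one_ne_zero)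
      hφ.injective_fderiv).measurable

theorem IsDiffeo.measurable_pushDensity (hφ : IsDiffeo φ) :
    Measurable (pushDensity φ : E n × OrientedGrassmannian n d → _) :=
  (continuous_jacobian (hφ.contDiff.continuous_fderiv one_ne_zero)).measurable.ennreal_ofReal

theorem IsDiffeo.pushDensity_ne_zero (hφ : IsDiffeo φ) (p : E n × OrientedGrassmannian n d) :
    pushDensity φ p ≠ 0 :=
  (ENNReal.ofReal_pos.2 (jacobian_pos (hφ.injective_fderiv _) _)).ne'

theorem IsDiffeo.pushMap_comp (hψ : IsDiffeo ψ) (hφ : IsDiffeo φ)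
    (p : E n × OrientedGrassmannian n d) : pushMap (ψ ∘ φ) p = pushMap ψ (pushMap φ p) := by
  simp only [pushMap, hψ.fderiv_comp hφ, Function.comp_apply]
  rw [transport_comp (hφ.injective_fderiv _) (hψ.injective_fderiv _)]

theorem IsDiffeo.pushDensity_comp (hψ : IsDiffeo ψ) (hφ : IsDiffeo φ)
    (p : E n × OrientedGrassmannian n d) :
    pushDensity (ψ ∘ φ) p = pushDensity φ p * pushDensity ψ (pushMap φ p) := by
  simp only [pushDensity, pushMap, hψ.fderiv_comp hφ]
  rw [jacobian_comp (hφ.injective_fderiv _), mul_comm,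
    ENNReal.ofReal_mul (jacobian_pos (hφ.injective_fderiv _) _).le]

theorem pushMap_id (p : E n × OrientedGrassmannian n d) : pushMap id p = p := by
  simp [pushMap, transport_id]

theorem pushDensity_id (p : E n × OrientedGrassmannian n d) : pushDensity id p = 1 := by
  simp [pushDensity, jacobian_id]

variable {μ : Measure (E n × OrientedGrassmannian n d)}

theorem pushforward_id : pushforward id μ = μ := by
  have h1 : (pushMap id : E n × OrientedGrassmannian n d → _) = id := funext pushMap_id
  have h2 : (pushDensity id : E n × OrientedGrassmannian n d → _) = 1 := funext pushDensity_id
  rw [pushforward_eq, h1, h2, withDensity_one, Measure.map_id]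

theorem IsDiffeo.pushforward_comp (hψ : IsDiffeo ψ) (hφ : IsDiffeo φ) :
    pushforward (ψ ∘ φ) μ = pushforward ψ (pushforward φ μ) := by
  have h1 : (pushMap (ψ ∘ φ) : E n × OrientedGrassmannian n d → _) = pushMap ψ ∘ pushMap φ :=
    funext fun p => hψ.pushMap_comp hφ p
  have h2 : (pushDensity (ψ ∘ φ) : E n × OrientedGrassmannian n d → _) =
      pushDensity φ * fun p => pushDensity ψ (pushMap φ p) :=
    funext fun p => hψ.pushDensity_comp hφ p
  rw [pushforward_eq, pushforward_eq, pushforward_eq, h1, h2,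
    ← Measure.map_map hψ.measurable_pushMap hφ.measurable_pushMap,
    withDensity_mul μ hφ.measurable_pushDensity (g := fun p => pushDensity ψ (pushMap φ p))
      (hψ.measurable_pushDensity.comp hφ.measurable_pushMap),
    map_withDensity_comp hφ.measurable_pushMap hψ.measurable_pushDensity.aemeasurable]

/-- The weight of `μ` with density the Jacobian of `φ`; it is the weight of `φ_# μ` pulled back
by `φ`. -/
def tilt (φ : E n → E n) (μ : Measure (E n × OrientedGrassmannian n d)) : Measure (E n) :=
  weight (μ.withDensity (pushDensity φ))

theorem IsDiffeo.weight_pushforward (hφ : IsDiffeo φ) :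
    weight (pushforward φ μ) = (tilt φ μ).map φ := by
  rw [tilt, weight, weight, pushforward_eq, Measure.map_map measurable_fst hφ.measurable_pushMap,
    Measure.map_map hφ.measurableEmbedding.measurable measurable_fst]
  rfl

theorem tilt_absolutelyContinuous : tilt φ μ ≪ weight μ :=
  (withDensity_absolutelyContinuous _ _).map measurable_fst

theorem IsDiffeo.absolutelyContinuous_tilt (hφ : IsDiffeo φ) : weight μ ≪ tilt φ μ :=
  (withDensity_absolutelyContinuous' hφ.measurable_pushDensity.aemeasurable
    (Eventually.of_forall hφ.pushDensity_ne_zero)).map measurable_fst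

theorem IsDiffeo.ae_weight_pushforward_iff (hφ : IsDiffeo φ) {P : E n → Prop} :
    (∀ᵐ y ∂weight (pushforward φ μ), P y) ↔ ∀ᵐ x ∂weight μ, P (φ x) := by
  rw [hφ.weight_pushforward, hφ.measurableEmbedding.ae_map_iff]
  exact ⟨fun h => hφ.absolutelyContinuous_tilt.ae_le h,
    fun h => tilt_absolutelyContinuous.ae_le h⟩

theorem IsDiffeo.aemeasurable_comp_invFun (hφ : IsDiffeo φ) {a : E n → ℝ}
    (ha : AEMeasurable a (weight μ)) :
    AEMeasurable (fun y => a (Function.invFun φ y)) (weight (pushforward φ μ)) := by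
  rw [hφ.weight_pushforward, hφ.measurableEmbedding.aemeasurable_map_iff]
  refine (ha.mono_ac tilt_absolutelyContinuous).congr (Eventually.of_forall fun x => ?_)
  simp [hφ.invFun_apply]

theorem IsDiffeo.lintegral_weight_pushforward (hφ : IsDiffeo φ) (f : E n → ℝ≥0∞) :
    ∫⁻ y, f (Function.invFun φ y) ∂weight (pushforward φ μ) = ∫⁻ x, f x ∂tilt φ μ := by
  rw [hφ.weight_pushforward, hφ.measurableEmbedding.lintegral_map]
  simp [hφ.invFun_apply]

theorem rescale_congr {a b : E n → ℝ} (h : a =ᵐ[weight μ] b) : rescale a μ = rescale b μ := by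
  refine withDensity_congr_ae ?_
  filter_upwards [ae_of_ae_map measurable_fst.aemeasurable h] with p hp
  rw [hp]

theorem rescale_rescale {a b : E n → ℝ} (ha : AEMeasurable a (weight μ))
    (hb : AEMeasurable b (weight μ)) (ha0 : ∀ x, 0 ≤ a x) :
    rescale b (rescale a μ) = rescale (fun x => a x * b x) μ := by
  have ha' : AEMeasurable (fun p : E n × OrientedGrassmannian n d => a p.1) μ :=
    ha.comp_measurable measurable_fst
  have hb' : AEMeasurable (fun p : E n × OrientedGrassmannian n d => b p.1) μ :=
    hb.comp_measurable measurable_fst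
  rw [rescale, rescale, rescale, ← withDensity_mul₀ ha'.ennreal_ofReal hb'.ennreal_ofReal]
  congr 1
  ext p
  exact (ENNReal.ofReal_mul (ha0 _)).symm

theorem weight_rescale {a : E n → ℝ} (ha : AEMeasurable a (weight μ)) :
    weight (rescale a μ) = (weight μ).withDensity fun x => ENNReal.ofReal (a x) :=
  map_withDensity_comp (g := fun x => ENNReal.ofReal (a x)) measurable_fst ha.ennreal_ofReal

theorem weight_rescale_absolutelyContinuous {a : E n → ℝ} : weight (rescale a μ) ≪ weight μ :=
  (withDensity_absolutelyContinuous _ _).map measurable_fst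

theorem ae_weight_rescale_iff {a : E n → ℝ} (ha : AEMeasurable a (weight μ))
    (hpos : ∀ᵐ x ∂weight μ, 0 < a x) {P : E n → Prop} :
    (∀ᵐ x ∂weight (rescale a μ), P x) ↔ ∀ᵐ x ∂weight μ, P x := by
  refine ⟨fun h => ?_, fun h => weight_rescale_absolutelyContinuous.ae_le h⟩
  rw [weight_rescale ha] at h
  refine (withDensity_absolutelyContinuous' ha.ennreal_ofReal ?_).ae_le h
  filter_upwards [hpos] with x hx
  exact (ENNReal.ofReal_pos.2 hx).ne'

theorem IsDiffeo.pushforward_rescale (hφ : IsDiffeo φ) {a : E n → ℝ}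
    (ha : AEMeasurable a (weight μ)) :
    pushforward φ (rescale a μ) = rescale (fun y => a (Function.invFun φ y)) (pushforward φ μ) := by
  have ha' : AEMeasurable (fun p : E n × OrientedGrassmannian n d => ENNReal.ofReal (a p.1)) μ :=
    (ha.comp_measurable measurable_fst).ennreal_ofReal
  have hJ : AEMeasurable (pushDensity φ) μ := hφ.measurable_pushDensity.aemeasurable
  have hinv : AEMeasurable (fun p : E n × OrientedGrassmannian n d =>
      ENNReal.ofReal (a (Function.invFun φ p.1)))
      ((μ.withDensity (pushDensity φ)).map (pushMap φ)) :=
    ((hφ.aemeasurable_comp_invFun ha).comp_measurable measurable_fst).ennreal_ofReal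
  have e : (fun p : E n × OrientedGrassmannian n d => ENNReal.ofReal (a p.1)) =
      fun p => ENNReal.ofReal (a (Function.invFun φ (pushMap φ p).1)) := by
    ext p
    rw [pushMap, hφ.invFun_apply]
  rw [pushforward_eq, rescale, ← withDensity_mul₀ ha' hJ, mul_comm, withDensity_mul₀ hJ ha', e,
    map_withDensity_comp hφ.measurable_pushMap hinv]
  rfl

theorem tilt_le {C : ℝ} (hC : ∀ p : E n × OrientedGrassmannian n d,
    jacobian (fderiv ℝ φ p.1) p.2 ≤ C) : tilt φ μ ≤ ENNReal.ofReal C • weight μ := by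
  rw [tilt, weight, weight, ← Measure.map_smul, ← withDensity_const]
  exact Measure.map_mono (withDensity_mono (Eventually.of_forall fun p =>
    ENNReal.ofReal_le_ofReal (hC p))) measurable_fst

theorem weight_le_smul_tilt {C : ℝ} (hC : ∀ p : E n × OrientedGrassmannian n d,
    1 ≤ C * jacobian (fderiv ℝ φ p.1) p.2) (hC0 : 0 ≤ C) :
    weight μ ≤ ENNReal.ofReal C • tilt φ μ := by
  rw [tilt, weight, weight, ← Measure.map_smul, ← withDensity_smul' _ _ ENNReal.ofReal_ne_top]
  refine Measure.map_mono ?_ measurable_fst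
  conv_lhs => rw [← withDensity_one (μ := μ)]
  refine withDensity_mono (Eventually.of_forall fun p => ?_)
  rw [Pi.smul_apply, smul_eq_mul, pushDensity, ← ENNReal.ofReal_mul hC0, Pi.one_apply,
    ← ENNReal.ofReal_one]
  exact ENNReal.ofReal_le_ofReal (hC p)

end Pushforward

/-! ### Time changes -/

theorem ae_unitTime_mem : ∀ᵐ t ∂unitTime, t ∈ Icc (0 : ℝ) 1 :=
  ae_restrict_mem measurableSet_Icc

theorem measurePreserving_one_sub : MeasurePreserving (fun t : ℝ => 1 - t) unitTime unitTime := by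
  have h := (Measure.measurePreserving_sub_left (volume : Measure ℝ) 1).restrict_preimage
    (s := Icc 0 1) measurableSet_Icc
  have e : (fun t : ℝ => 1 - t) ⁻¹' Icc 0 1 = Icc 0 1 := by
    ext t
    simp only [mem_preimage, mem_Icc]
    constructor <;> rintro ⟨h1, h2⟩ <;> constructor <;> linarith
  rwa [e] at h

theorem measurableEmbedding_one_sub : MeasurableEmbedding fun t : ℝ => 1 - t :=
  (Homeomorph.subLeft (1 : ℝ)).measurableEmbedding

theorem measurableEmbedding_sub_div {a : ℝ} (ha : a ≠ 0) (b : ℝ) :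
    MeasurableEmbedding fun t : ℝ => (t - b) / a :=
  (measurableEmbedding_mulRight₀ (inv_ne_zero ha)).comp (measurableEmbedding_subRight b)

theorem map_restrict_sub_div {a : ℝ} (ha : 0 < a) (b : ℝ) :
    (volume.restrict (Icc b (b + a))).map (fun t => (t - b) / a) =
      ENNReal.ofReal a • unitTime := by
  have e : Icc b (b + a) = (fun t => (t - b) / a) ⁻¹' Icc 0 1 := by
    ext t
    simp only [mem_preimage, mem_Icc, le_div_iff₀ ha, div_le_iff₀ ha]
    constructor <;> rintro ⟨h1, h2⟩ <;> constructor <;> linarith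
  have hm : (volume : Measure ℝ).map (fun t => (t - b) / a) = ENNReal.ofReal a • volume := by
    have : (fun t : ℝ => (t - b) / a) = (fun t => t * a⁻¹) ∘ fun t => t - b := rfl
    rw [this, ← Measure.map_map (measurable_mul_const _) (measurable_sub_const _),
      (measurePreserving_sub_right volume b).map_eq,
      Real.map_volume_mul_right (inv_ne_zero ha.ne'), inv_inv, abs_of_pos ha]
  rw [e, ← (measurableEmbedding_sub_div ha.ne' b).restrict_map, hm, Measure.restrict_smul,
    unitTime]

theorem lintegral_restrict_sub_div {a : ℝ} (ha : 0 < a) (b : ℝ) (f : ℝ → ℝ≥0∞) :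
    ∫⁻ t in Icc b (b + a), f ((t - b) / a) = ENNReal.ofReal a * ∫⁻ t, f t ∂unitTime := by
  rw [← (measurableEmbedding_sub_div ha.ne' b).lintegral_map, map_restrict_sub_div ha,
    lintegral_smul_measure, smul_eq_mul]

theorem quasiMeasurePreserving_sub_div {a : ℝ} (ha : 0 < a) (b : ℝ) :
    Measure.QuasiMeasurePreserving (fun t => (t - b) / a) (volume.restrict (Icc b (b + a)))
      unitTime := by
  refine ⟨(measurableEmbedding_sub_div ha.ne' b).measurable, ?_⟩
  rw [map_restrict_sub_div ha]
  exact Measure.smul_absolutelyContinuous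

/-! ### Concatenation in time -/

/-- The concatenation of two paths, the first one run during `[0, l]` and the second one during
`[l, 1]`. -/
def concat {G : Type*} (l : ℝ) (f g : ℝ → G) (t : ℝ) : G :=
  if t ≤ l then f (t / l) else g ((t - l) / (1 - l))

theorem concat_of_le {G : Type*} {l t : ℝ} (f g : ℝ → G) (h : t ≤ l) :
    concat l f g t = f (t / l) := if_pos h

theorem concat_of_lt {G : Type*} {l t : ℝ} (f g : ℝ → G) (h : l < t) :
    concat l f g t = g ((t - l) / (1 - l)) := if_neg h.not_ge

/-- At `t = l` the first branch is taken; matching endpoints let the second formula hold on the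
closed interval, as needed to glue continuity. -/
theorem concat_of_ge {G : Type*} {l t : ℝ} {f g : ℝ → G} (hl : 0 < l) (hfg : f 1 = g 0)
    (h : l ≤ t) : concat l f g t = g ((t - l) / (1 - l)) := by
  rcases h.eq_or_lt with rfl | h
  · rw [concat_of_le _ _ le_rfl, div_self hl.ne', sub_self, zero_div, hfg]
  · exact concat_of_lt _ _ h

theorem map_concat {G H : Type*} (A : G → H) (l : ℝ) (f g : ℝ → G) (t : ℝ) :
    A (concat l f g t) = concat l (fun s => A (f s)) (fun s => A (g s)) t := by
  unfold concat
  split_ifs <;> rfl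

theorem map₂_concat {G G' H : Type*} (A : G → G' → H) (l : ℝ) (f g : ℝ → G) (f' g' : ℝ → G')
    (t : ℝ) : A (concat l f g t) (concat l f' g' t) =
      concat l (fun s => A (f s) (f' s)) (fun s => A (g s) (g' s)) t := by
  unfold concat
  split_ifs <;> rfl

variable {l : ℝ}

theorem unitTime_restrict_Iic (hl1 : l < 1) :
    unitTime.restrict (Iic l) = volume.restrict (Icc 0 (0 + l)) := by
  rw [unitTime, Measure.restrict_restrict measurableSet_Iic]
  congr 1
  ext t
  simp only [mem_inter_iff, mem_Iic, mem_Icc]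
  constructor
  · rintro ⟨h1, h2, -⟩
    exact ⟨h2, by linarith⟩
  · rintro ⟨h1, h2⟩
    exact ⟨by linarith, h1, by linarith⟩

theorem unitTime_restrict_Ioi (hl : 0 < l) :
    unitTime.restrict (Iic l)ᶜ = volume.restrict (Icc l (l + (1 - l))) := by
  rw [compl_Iic, unitTime, Measure.restrict_restrict measurableSet_Ioi, add_sub_cancel,
    ← Measure.restrict_congr_set Ioc_ae_eq_Icc]
  congr 1
  ext t
  simp only [mem_inter_iff, mem_Ioi, mem_Icc, mem_Ioc]
  constructor
  · rintro ⟨h1, -, h2⟩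
    exact ⟨h1, h2⟩
  · rintro ⟨h1, h2⟩
    exact ⟨h1, by linarith, h2⟩

theorem lintegral_concat (hl : 0 < l) (hl1 : l < 1) (f g : ℝ → ℝ≥0∞) :
    ∫⁻ t, concat l f g t ∂unitTime =
      ENNReal.ofReal l * ∫⁻ t, f t ∂unitTime + ENNReal.ofReal (1 - l) * ∫⁻ t, g t ∂unitTime := by
  rw [← lintegral_add_compl _ (measurableSet_Iic (a := l)),
    setLIntegral_congr_fun (g := fun t => f ((t - 0) / l)) measurableSet_Iic
      (fun t ht => by simp only [sub_zero, concat_of_le f g ht]),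
    setLIntegral_congr_fun (g := fun t => g ((t - l) / (1 - l))) measurableSet_Iic.compl
      (fun t ht => concat_of_lt f g (not_le.1 ht)),
    unitTime_restrict_Iic hl1, unitTime_restrict_Ioi hl, lintegral_restrict_sub_div hl,
    lintegral_restrict_sub_div (sub_pos.2 hl1)]

theorem aestronglyMeasurable_concat {G : Type*} [TopologicalSpace G]
    [TopologicalSpace.PseudoMetrizableSpace G] (hl : 0 < l) (hl1 : l < 1) {f g : ℝ → G}
    (hf : AEStronglyMeasurable f unitTime) (hg : AEStronglyMeasurable g unitTime) :
    AEStronglyMeasurable (concat l f g) unitTime := by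
  classical
  refine AEStronglyMeasurable.piecewise (s := Iic l) (f := fun t => f (t / l))
    (g := fun t => g ((t - l) / (1 - l))) measurableSet_Iic ?_ ?_
  · rw [unitTime_restrict_Iic hl1]
    have h := hf.comp_quasiMeasurePreserving (quasiMeasurePreserving_sub_div hl 0)
    simp only [sub_zero] at h
    exact h
  · rw [unitTime_restrict_Ioi hl]
    exact hg.comp_quasiMeasurePreserving (quasiMeasurePreserving_sub_div (sub_pos.2 hl1) l)

theorem aestronglyMeasurable_uncurry_concat {X G : Type*} [MeasurableSpace X] {m : Measure X}
    [SFinite m] [TopologicalSpace G] [TopologicalSpace.PseudoMetrizableSpace G] (hl : 0 < l)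
    (hl1 : l < 1) {f g : ℝ → X → G}
    (hf : AEStronglyMeasurable (Function.uncurry f) (unitTime.prod m))
    (hg : AEStronglyMeasurable (Function.uncurry g) (unitTime.prod m)) :
    AEStronglyMeasurable (Function.uncurry (concat l f g)) (unitTime.prod m) := by
  classical
  have e : Function.uncurry (concat l f g) = (Iic l ×ˢ (univ : Set X)).piecewise
      (fun p => f ((p.1 - 0) / l) p.2) (fun p => g ((p.1 - l) / (1 - l)) p.2) := by
    ext p
    by_cases hp : p.1 ≤ l
    · rw [piecewise_eq_of_mem _ _ _ (show p ∈ Iic l ×ˢ (univ : Set X) from ⟨hp, mem_univ _⟩),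
        Function.uncurry, concat_of_le f g hp, sub_zero]
    · rw [piecewise_eq_of_notMem _ _ _ (fun h : p ∈ Iic l ×ˢ (univ : Set X) => hp h.1),
        Function.uncurry, concat_of_lt f g (not_le.1 hp)]
  have hcompl : (Iic l ×ˢ (univ : Set X))ᶜ = (Iic l)ᶜ ×ˢ univ := by ext; simp
  rw [e]
  refine AEStronglyMeasurable.piecewise (measurableSet_Iic.prod MeasurableSet.univ) ?_ ?_
  · rw [← Measure.prod_restrict, Measure.restrict_univ, unitTime_restrict_Iic hl1]
    exact hf.comp_quasiMeasurePreserving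
      (QuasiMeasurePreserving.prodMap (quasiMeasurePreserving_sub_div hl 0)
        (Measure.QuasiMeasurePreserving.id m))
  · rw [hcompl, ← Measure.prod_restrict, Measure.restrict_univ, unitTime_restrict_Ioi hl]
    exact hg.comp_quasiMeasurePreserving (QuasiMeasurePreserving.prodMap
      (quasiMeasurePreserving_sub_div (sub_pos.2 hl1) l) (Measure.QuasiMeasurePreserving.id m))

section IntegralConcat

variable {G : Type*} [NormedAddCommGroup G]

theorem integrableOn_concat (hl : 0 < l) (hl1 : l < 1) {f g : ℝ → G}
    (hf : IntegrableOn f (Icc 0 1)) (hg : IntegrableOn g (Icc 0 1)) :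
    IntegrableOn (concat l f g) (Icc 0 1) := by
  refine ⟨aestronglyMeasurable_concat hl hl1 hf.1 hg.1, ?_⟩
  change ∫⁻ t, ‖concat l f g t‖ₑ ∂unitTime < ⊤
  simp only [map_concat (fun x : G => ‖x‖ₑ)]
  rw [lintegral_concat hl hl1]
  exact ENNReal.add_lt_top.2 ⟨ENNReal.mul_lt_top ENNReal.ofReal_lt_top hf.2,
    ENNReal.mul_lt_top ENNReal.ofReal_lt_top hg.2⟩

variable [NormedSpace ℝ G]

theorem integral_concat_of_le (hl : 0 < l) (f g : ℝ → G) {t : ℝ} (htl : t ≤ l) :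
    ∫ s in (0 : ℝ)..t, concat l f g s = l • ∫ s in (0 : ℝ)..(t / l), f s := by
  rw [intervalIntegral.integral_congr (g := fun s => f (s / l)) fun s hs => ?_,
    intervalIntegral.integral_comp_div f hl.ne', zero_div]
  refine concat_of_le f g ?_
  rw [mem_uIcc] at hs
  rcases hs with hs | hs <;> linarith

theorem integral_concat_of_ge (hl : 0 < l) (hl1 : l < 1) {f g : ℝ → G}
    (hf : IntegrableOn f (Icc 0 1)) (hg : IntegrableOn g (Icc 0 1)) {t : ℝ} (htl : l ≤ t)
    (ht : t ≤ 1) :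
    ∫ s in (0 : ℝ)..t, concat l f g s =
      l • (∫ s in (0 : ℝ)..1, f s) + (1 - l) • ∫ s in (0 : ℝ)..((t - l) / (1 - l)), g s := by
  have hi := integrableOn_concat hl hl1 hf hg
  have h0 : (0 : ℝ) ∈ Icc (0 : ℝ) 1 := by simp
  have hlm : l ∈ Icc (0 : ℝ) 1 := ⟨hl.le, hl1.le⟩
  have htm : t ∈ Icc (0 : ℝ) 1 := ⟨hl.le.trans htl, ht⟩
  rw [← intervalIntegral.integral_add_adjacent_intervals
    (intervalIntegrable_of_integrableOn_unit hi h0 hlm)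
    (intervalIntegrable_of_integrableOn_unit hi hlm htm),
    integral_concat_of_le hl f g le_rfl, div_self hl.ne']
  congr 1
  -- The half-open interval excludes `s = l`, where `concat` takes the first branch and the
  -- integrands need not match.
  rw [intervalIntegral.integral_congr_ae (g := fun s => g ((s - l) / (1 - l)))
    (Eventually.of_forall fun s hs => ?_)]
  · rw [intervalIntegral.integral_comp_sub_right (fun s => g (s / (1 - l))),
      intervalIntegral.integral_comp_div g (sub_pos.2 hl1).ne', sub_self, zero_div]
  · rw [uIoc_of_le htl] at hs
    exact concat_of_lt f g hs.1

end IntegralConcat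

/-! ### Admissible paths -/

/-! ### Square integrability through lower integrals -/

section LpTwo

variable {α G : Type*} [MeasurableSpace α] [NormedAddCommGroup G] {m : Measure α} {f : α → G}

theorem eLpNorm_two_eq :
    eLpNorm f 2 m = (∫⁻ x, ENNReal.ofReal (‖f x‖ ^ 2) ∂m) ^ (1 / 2 : ℝ) := by
  have e : ∀ x, ‖f x‖ₑ ^ (2 : ℝ) = ENNReal.ofReal (‖f x‖ ^ 2) := fun x => by
    rw [ENNReal.rpow_ofNat, ENNReal.ofReal_pow (norm_nonneg _), ofReal_norm]
  rw [eLpNorm_eq_lintegral_rpow_enorm_toReal two_ne_zero ENNReal.ofNat_ne_top,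
    ENNReal.toReal_ofNat]
  simp only [e]

theorem memLp_two_iff_lintegral_sq (hf : AEStronglyMeasurable f m) :
    MemLp f 2 m ↔ ∫⁻ x, ENNReal.ofReal (‖f x‖ ^ 2) ∂m < ⊤ := by
  rw [MemLp, and_iff_right hf, eLpNorm_two_eq, ENNReal.rpow_lt_top_iff_of_pos (by norm_num)]

/-- On a probability space the `L¹` norm is at most the `L²` norm. -/
theorem ofReal_sq_norm_integral_le [NormedSpace ℝ G] [IsProbabilityMeasure m]
    (hf : AEStronglyMeasurable f m) :
    ENNReal.ofReal (‖∫ x, f x ∂m‖ ^ 2) ≤ ∫⁻ x, ENNReal.ofReal (‖f x‖ ^ 2) ∂m := by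
  have h1 : ‖∫ x, f x ∂m‖ₑ ≤ (∫⁻ x, ENNReal.ofReal (‖f x‖ ^ 2) ∂m) ^ (1 / 2 : ℝ) := by
    rw [← eLpNorm_two_eq]
    refine (enorm_integral_le_lintegral_enorm f).trans ?_
    rw [← eLpNorm_one_eq_lintegral_enorm]
    exact eLpNorm_le_eLpNorm_of_exponent_le one_le_two hf
  rw [ENNReal.ofReal_pow (norm_nonneg _), ofReal_norm]
  calc ‖∫ x, f x ∂m‖ₑ ^ 2 ≤ ((∫⁻ x, ENNReal.ofReal (‖f x‖ ^ 2) ∂m) ^ (1 / 2 : ℝ)) ^ 2 := by gcongr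
    _ = _ := by rw [← ENNReal.rpow_ofNat, ← ENNReal.rpow_mul]; norm_num

end LpTwo

instance : IsProbabilityMeasure unitTime := ⟨by simp [unitTime]⟩

section Weight

variable {n d : ℕ}

instance (μ : Varifold n d) : IsFiniteMeasure (weight μ.toMeasure) := by
  unfold weight; infer_instance

/-- The Fisher-Rao part `∫₀¹ ∫ η_t² ∘ φ_t⁻¹ d|(φ_t)_# μ| dt` of the energy, pulled back to the
initial varifold. -/
def weightEnergy (μ : Measure (E n × OrientedGrassmannian n d)) (φ : ℝ → E n → E n)
    (η : ℝ → E n → ℝ) : ℝ≥0∞ :=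
  ∫⁻ t, ∫⁻ x, ENNReal.ofReal (η t x ^ 2) ∂tilt (φ t) μ ∂unitTime

theorem ae_integrableOn_of_memLp {m : Measure (E n)} [IsFiniteMeasure m] {η : ℝ → E n → ℝ}
    (hη : MemLp (Function.uncurry η) 2 (unitTime.prod m)) :
    ∀ᵐ x ∂m, IntegrableOn (fun s => η s x) (Icc 0 1) :=
  (hη.integrable one_le_two).prod_left_ae

theorem integral_unitTime {G : Type*} [NormedAddCommGroup G] [NormedSpace ℝ G] (f : ℝ → G) :
    ∫ s in (0 : ℝ)..1, f s = ∫ s, f s ∂unitTime := by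
  rw [intervalIntegral.integral_of_le zero_le_one, unitTime, integral_Icc_eq_integral_Ioc]

theorem aemeasurable_sqrtWeight_one {m : Measure (E n)} [IsFiniteMeasure m] {η : ℝ → E n → ℝ}
    (hη : AEStronglyMeasurable (Function.uncurry η) (unitTime.prod m)) :
    AEMeasurable (sqrtWeight η 1) m := by
  have h := (hη.prod_swap.integral_prod_right' (μ := m) (ν := unitTime)).aemeasurable
  refine ((h.const_mul (1 / 2)).const_add 1).congr (Eventually.of_forall fun x => ?_)
  simp only [sqrtWeight, integral_unitTime]
  rfl

theorem tilt_rescale {φ : E n → E n} (hφ : IsDiffeo φ)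
    {μ : Measure (E n × OrientedGrassmannian n d)} {a : E n → ℝ}
    (ha : AEMeasurable a (weight μ)) :
    tilt φ (rescale a μ) = (tilt φ μ).withDensity fun x => ENNReal.ofReal (a x) := by
  have ha' : AEMeasurable (fun p : E n × OrientedGrassmannian n d => ENNReal.ofReal (a p.1)) μ :=
    (ha.comp_measurable measurable_fst).ennreal_ofReal
  have hJ : AEMeasurable (pushDensity φ) μ := hφ.measurable_pushDensity.aemeasurable
  rw [tilt, rescale, ← withDensity_mul₀ ha' hJ, mul_comm, withDensity_mul₀ hJ ha']
  exact weight_rescale (ha.mono_ac tilt_absolutelyContinuous)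

end Weight

section Admissible

variable {n d : ℕ} {V : Type*} [NormedAddCommGroup V] [InnerProductSpace ℝ V]
  {F : FieldSpace n V} {μ ν : Varifold n d} {v : ℝ → V} {φ : ℝ → E n → E n} {η : ℝ → E n → ℝ}

theorem energy_eq (hv : MemLp v 2 unitTime) (hφ : IsFlow F v φ) (γ : ℝ) :
    energy γ μ v φ η = ENNReal.ofReal (1 / 2) * (∫⁻ t, ENNReal.ofReal (‖v t‖ ^ 2) ∂unitTime) +
      ENNReal.ofReal (γ / 2) * weightEnergy μ.toMeasure φ η := by
  rw [energy, weightEnergy]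
  congr 2
  refine lintegral_congr_ae ?_
  filter_upwards [ae_unitTime_mem] with t ht
  exact (hφ.isDiffeo hv ht).lintegral_weight_pushforward fun x => ENNReal.ofReal (η t x ^ 2)

theorem IsFlow.tilt_le (hφ : IsFlow F v φ) (hv : MemLp v 2 unitTime) {t : ℝ}
    (ht : t ∈ Icc (0 : ℝ) 1) (μ : Measure (E n × OrientedGrassmannian n d)) :
    tilt (φ t) μ ≤ ENNReal.ofReal (jacobianBound d (Real.exp (flowConst F v))) • weight μ :=
  LddmmFR.tilt_le fun _ => jacobian_le (hφ.norm_fderiv_apply_le hv ht _) _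

theorem IsFlow.weight_le (hφ : IsFlow F v φ) (hv : MemLp v 2 unitTime) {t : ℝ}
    (ht : t ∈ Icc (0 : ℝ) 1) (μ : Measure (E n × OrientedGrassmannian n d)) :
    weight μ ≤ ENNReal.ofReal (jacobianBound d (Real.exp (flowConst F v))) • tilt (φ t) μ :=
  weight_le_smul_tilt (fun _ => one_le_jacobianBound_mul (hφ.norm_le_norm_fderiv_apply hv ht _) _)
    (Real.sqrt_nonneg _)

theorem lintegral_sq_uncurry
    (hη : AEStronglyMeasurable (Function.uncurry η) (unitTime.prod (weight μ.toMeasure))) :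
    ∫⁻ z, ENNReal.ofReal (‖Function.uncurry η z‖ ^ 2) ∂unitTime.prod (weight μ.toMeasure) =
      ∫⁻ t, ∫⁻ x, ENNReal.ofReal (η t x ^ 2) ∂weight μ.toMeasure ∂unitTime := by
  rw [lintegral_prod _ (hη.norm.aemeasurable.pow_const 2).ennreal_ofReal]
  simp [Function.uncurry]

theorem IsFlow.weightEnergy_le (hφ : IsFlow F v φ) (hv : MemLp v 2 unitTime) :
    weightEnergy μ.toMeasure φ η ≤ ENNReal.ofReal (jacobianBound d (Real.exp (flowConst F v))) *
      ∫⁻ t, ∫⁻ x, ENNReal.ofReal (η t x ^ 2) ∂weight μ.toMeasure ∂unitTime := by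
  rw [weightEnergy, ← lintegral_const_mul' _ _ ENNReal.ofReal_ne_top]
  refine lintegral_mono_ae ?_
  filter_upwards [ae_unitTime_mem] with t ht
  refine (lintegral_mono' (hφ.tilt_le hv ht μ.toMeasure) le_rfl).trans_eq ?_
  rw [lintegral_smul_measure, smul_eq_mul]

theorem IsFlow.le_weightEnergy (hφ : IsFlow F v φ) (hv : MemLp v 2 unitTime) :
    ∫⁻ t, ∫⁻ x, ENNReal.ofReal (η t x ^ 2) ∂weight μ.toMeasure ∂unitTime ≤
      ENNReal.ofReal (jacobianBound d (Real.exp (flowConst F v))) *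
        weightEnergy μ.toMeasure φ η := by
  rw [weightEnergy, ← lintegral_const_mul' _ _ ENNReal.ofReal_ne_top]
  refine lintegral_mono_ae ?_
  filter_upwards [ae_unitTime_mem] with t ht
  refine (lintegral_mono' (hφ.weight_le hv ht μ.toMeasure) le_rfl).trans_eq ?_
  rw [lintegral_smul_measure, smul_eq_mul]

/-- The Jacobians of the flow are bounded above and away from zero, uniformly in time and plane.
Square integrability of reversed and concatenated controls can thus be read off from their exact
energy identities. -/
theorem IsFlow.memLp_weight_iff (hφ : IsFlow F v φ) (hv : MemLp v 2 unitTime)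
    (hη : AEStronglyMeasurable (Function.uncurry η) (unitTime.prod (weight μ.toMeasure))) :
    MemLp (Function.uncurry η) 2 (unitTime.prod (weight μ.toMeasure)) ↔
      weightEnergy μ.toMeasure φ η < ⊤ := by
  rw [memLp_two_iff_lintegral_sq hη, lintegral_sq_uncurry hη]
  exact ⟨fun h => (hφ.weightEnergy_le hv).trans_lt (ENNReal.mul_lt_top ENNReal.ofReal_lt_top h),
    fun h => (hφ.le_weightEnergy hv).trans_lt (ENNReal.mul_lt_top ENNReal.ofReal_lt_top h)⟩

theorem Admissible.isDiffeo (h : Admissible F μ v φ η) {t : ℝ} (ht : t ∈ Icc (0 : ℝ) 1) :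
    IsDiffeo (φ t) := h.isFlow.isDiffeo h.memLp_field ht

theorem Admissible.isDiffeo_one (h : Admissible F μ v φ η) : IsDiffeo (φ 1) :=
  h.isDiffeo (by simp)

theorem Admissible.energy_ne_top (h : Admissible F μ v φ η) (γ : ℝ) :
    energy γ μ v φ η ≠ ⊤ := by
  rw [energy_eq h.memLp_field h.isFlow]
  refine (ENNReal.add_lt_top.2 ⟨ENNReal.mul_lt_top ENNReal.ofReal_lt_top ?_,
    ENNReal.mul_lt_top ENNReal.ofReal_lt_top ?_⟩).ne
  · exact (memLp_two_iff_lintegral_sq h.memLp_field.1).1 h.memLp_field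
  · exact (h.isFlow.memLp_weight_iff h.memLp_field h.memLp_weight.1).1 h.memLp_weight

theorem Admissible.aemeasurable (h : Admissible F μ v φ η) :
    AEMeasurable (sqrtWeight η 1) (weight μ.toMeasure) :=
  aemeasurable_sqrtWeight_one h.memLp_weight.1

theorem Admissible.transformed_eq (h : Admissible F μ v φ η) :
    transformed μ φ η 1 =
      pushforward (φ 1) (rescale (fun x => sqrtWeight η 1 x ^ 2) μ.toMeasure) :=
  (h.isDiffeo_one.pushforward_rescale (h.aemeasurable.pow_const 2)).symm

theorem Admissible.ae_pos (h : Admissible F μ v φ η) :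
    ∀ᵐ x ∂weight μ.toMeasure, 0 < sqrtWeight η 1 x := by
  filter_upwards [h.pos] with x hx
  exact hx 1 (by simp)

/-- The final weight is positive almost everywhere and the Jacobian everywhere, so `φ 1` matches
null sets in both directions. This transfers the almost-everywhere conditions between the two ends
of a path. -/
theorem Admissible.ae_weight_iff (h : Admissible F μ v φ η)
    (hν : ν.toMeasure = transformed μ φ η 1) {P : E n → Prop} :
    (∀ᵐ y ∂weight ν.toMeasure, P y) ↔ ∀ᵐ x ∂weight μ.toMeasure, P (φ 1 x) := by
  rw [hν, h.transformed_eq, h.isDiffeo_one.ae_weight_pushforward_iff,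
    ae_weight_rescale_iff (h.aemeasurable.pow_const 2)]
  filter_upwards [h.ae_pos] with x hx
  positivity

theorem Admissible.quasiMeasurePreserving (h : Admissible F μ v φ η)
    (hν : ν.toMeasure = transformed μ φ η 1) :
    Measure.QuasiMeasurePreserving (φ 1) (weight μ.toMeasure) (weight ν.toMeasure) := by
  refine ⟨h.isDiffeo_one.measurableEmbedding.measurable, ?_⟩
  refine Measure.AbsolutelyContinuous.mk fun s hs h0 => ?_
  rw [Measure.map_apply h.isDiffeo_one.measurableEmbedding.measurable hs]
  have h1 : ∀ᵐ y ∂weight ν.toMeasure, y ∉ s := measure_eq_zero_iff_ae_notMem.1 h0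
  exact measure_eq_zero_iff_ae_notMem.2 ((h.ae_weight_iff hν).1 h1)

theorem IsDiffeo.measurable_invFun {f : E n → E n} (hf : IsDiffeo f) :
    Measurable (Function.invFun f) := by
  have e : Function.invFun f = hf.isHomeomorph.homeomorph.symm := by
    ext1 y
    obtain ⟨x, rfl⟩ := hf.isHomeomorph.surjective y
    rw [hf.invFun_apply]
    exact (hf.isHomeomorph.homeomorph.symm_apply_apply x).symm
  rw [e]
  exact hf.isHomeomorph.homeomorph.symm.continuous.measurable

theorem Admissible.quasiMeasurePreserving_invFun (h : Admissible F μ v φ η)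
    (hν : ν.toMeasure = transformed μ φ η 1) :
    Measure.QuasiMeasurePreserving (Function.invFun (φ 1)) (weight ν.toMeasure)
      (weight μ.toMeasure) := by
  refine ⟨h.isDiffeo_one.measurable_invFun, ?_⟩
  refine Measure.AbsolutelyContinuous.mk fun s hs h0 => ?_
  rw [Measure.map_apply h.isDiffeo_one.measurable_invFun hs]
  have h1 : ∀ᵐ x ∂weight μ.toMeasure, x ∉ s := measure_eq_zero_iff_ae_notMem.1 h0
  refine measure_eq_zero_iff_ae_notMem.2 ((h.ae_weight_iff hν).2 ?_)
  simpa [h.isDiffeo_one.invFun_apply] using h1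

/-- Change of variables along the path from `μ` to `ν`. -/
theorem Admissible.lintegral_tilt (h : Admissible F μ v φ η)
    (hν : ν.toMeasure = transformed μ φ η 1) {ψ : E n → E n} (hψ : IsDiffeo ψ)
    (f : E n → ℝ≥0∞) :
    ∫⁻ y, f y ∂tilt ψ ν.toMeasure =
      ∫⁻ x, ENNReal.ofReal (sqrtWeight η 1 x ^ 2) * f (φ 1 x) ∂tilt (ψ ∘ φ 1) μ.toMeasure := by
  have hφ := h.isDiffeo_one
  have ha := h.aemeasurable.pow_const 2
  rw [← hψ.lintegral_weight_pushforward, hν, h.transformed_eq, ← hψ.pushforward_comp hφ]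
  have e : ∀ y, f (Function.invFun ψ y) = (fun x => f (φ 1 x)) (Function.invFun (ψ ∘ φ 1) y) :=
    fun y => by simp only [hψ.invFun_comp hφ, hφ.apply_invFun]
  simp only [e]
  -- No measurability of `f` is required: the density is finite, and diffeomorphisms are measurable
  -- embeddings. The time slices of a control can therefore be inserted directly.
  rw [(hψ.comp hφ).lintegral_weight_pushforward fun x => f (φ 1 x), tilt_rescale (hψ.comp hφ) ha,
    lintegral_withDensity_eq_lintegral_mul_non_measurable₀ _
      (ha.mono_ac tilt_absolutelyContinuous).ennreal_ofReal
      (Eventually.of_forall fun _ => ENNReal.ofReal_lt_top)]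
  rfl

/-- Composition of the weight changes and of the pushforwards along the path from `μ` to `ν`. -/
theorem Admissible.rescale_pushforward (h : Admissible F μ v φ η)
    (hν : ν.toMeasure = transformed μ φ η 1) {ψ : E n → E n} (hψ : IsDiffeo ψ)
    {β : E n → ℝ} (hβ : AEMeasurable β (weight ν.toMeasure)) {b : E n → ℝ}
    (hb : ∀ᵐ x ∂weight μ.toMeasure, b x = sqrtWeight η 1 x * β (φ 1 x)) :
    rescale (fun y => β (Function.invFun ψ y) ^ 2) (pushforward ψ ν.toMeasure) =
      rescale (fun y => b (Function.invFun (ψ ∘ φ 1) y) ^ 2)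
        (pushforward (ψ ∘ φ 1) μ.toMeasure) := by
  have hφ := h.isDiffeo_one
  have ha := h.aemeasurable.pow_const 2
  have hβφ : AEMeasurable (fun x => β (φ 1 x)) (weight μ.toMeasure) :=
    hβ.comp_quasiMeasurePreserving (h.quasiMeasurePreserving hν)
  have hbm : AEMeasurable b (weight μ.toMeasure) :=
    (h.aemeasurable.mul hβφ).congr (hb.mono fun x hx => hx.symm)
  rw [← hψ.pushforward_rescale (a := fun y => β y ^ 2) (hβ.pow_const 2),
    ← (hψ.comp hφ).pushforward_rescale (a := fun y => b y ^ 2) (hbm.pow_const 2),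
    hψ.pushforward_comp hφ]
  congr 1
  have e : (fun y => β y ^ 2) = fun y => (fun x => β (φ 1 x) ^ 2) (Function.invFun (φ 1) y) := by
    ext y
    simp only [hφ.apply_invFun]
  rw [e, hν, h.transformed_eq, ← hφ.pushforward_rescale
    ((hβφ.pow_const 2).mono_ac weight_rescale_absolutelyContinuous),
    rescale_rescale ha (hβφ.pow_const 2) fun x => sq_nonneg _]
  congr 1
  refine rescale_congr (hb.mono fun x hx => ?_)
  simp only [hx, mul_pow]

end Admissible

/-! ### Reversal and concatenation of paths -/

section Paths

variable {n d : ℕ} {V : Type*} [NormedAddCommGroup V] [InnerProductSpace ℝ V]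
  {F : FieldSpace n V} {γ : ℝ} {μ ν ρ : Varifold n d} {v v' : ℝ → V} {φ φ' : ℝ → E n → E n}
  {η η' : ℝ → E n → ℝ}

/-- There is an admissible path of energy `c` from `μ` to `ν`. -/
def Joins (F : FieldSpace n V) (γ : ℝ) (μ ν : Varifold n d) (c : ℝ≥0∞) : Prop :=
  ∃ v φ η, Admissible F μ v φ η ∧ ν.toMeasure = transformed μ φ η 1 ∧ c = energy γ μ v φ η

theorem Joins.refl (F : FieldSpace n V) (γ : ℝ) (μ : Varifold n d) : Joins F γ μ μ 0 := by
  refine ⟨0, fun _ => id, 0, ⟨MemLp.zero, fun x => ⟨continuousOn_const, fun t _ => by simp⟩, ?_, ?_⟩,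
    ?_, ?_⟩
  · exact MemLp.zero
  · simp [sqrtWeight]
  · simp [transformed, pushforward_id, rescale, sqrtWeight]
  · simp [energy]

/-- The time-reversed flow. -/
def reverseFlow (φ : ℝ → E n → E n) (t : ℝ) (y : E n) : E n := φ (1 - t) (Function.invFun (φ 1) y)

/-- The weight control of the time-reversed path. -/
def reverseWeight (φ : ℝ → E n → E n) (η : ℝ → E n → ℝ) (t : ℝ) (y : E n) : ℝ :=
  -(η (1 - t) (Function.invFun (φ 1) y) / sqrtWeight η 1 (Function.invFun (φ 1) y))

theorem one_sub_mem_Icc {t : ℝ} (ht : t ∈ Icc (0 : ℝ) 1) : 1 - t ∈ Icc (0 : ℝ) 1 :=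
  ⟨by linarith [ht.2], by linarith [ht.1]⟩

theorem IsFlow.reverse (hφ : IsFlow F v φ) (hv : MemLp v 2 unitTime) :
    IsFlow F (fun t => -v (1 - t)) (reverseFlow φ) := by
  intro y
  have h1 : (1 : ℝ) ∈ Icc (0 : ℝ) 1 := by simp
  refine ⟨(hφ _).1.comp (by fun_prop) fun t ht => one_sub_mem_Icc ht, fun t ht => ?_⟩
  have h := hφ.sub_eq_integral hv (one_sub_mem_Icc ht) h1 (Function.invFun (φ 1) y)
  rw [(hφ.isDiffeo hv h1).apply_invFun] at h
  simp only [reverseFlow, map_neg, Pi.neg_apply, intervalIntegral.integral_neg]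
  rw [intervalIntegral.integral_comp_sub_left
    (fun s => F.field (v s) (φ s (Function.invFun (φ 1) y))), sub_zero, ← h]
  abel

/-- The integral of `η` over `[1 - t, 1]` is the full integral minus that over `[0, 1 - t]`;
dividing by the final weight makes the reversed path start at `1`. -/
theorem Admissible.sqrtWeight_reverse (h : Admissible F μ v φ η) :
    ∀ᵐ x ∂weight μ.toMeasure, ∀ t ∈ Icc (0 : ℝ) 1,
      sqrtWeight (reverseWeight φ η) t (φ 1 x) = sqrtWeight η (1 - t) x / sqrtWeight η 1 x := by
  filter_upwards [h.ae_pos, ae_integrableOn_of_memLp h.memLp_weight] with x hx hi t ht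
  have h0 : (0 : ℝ) ∈ Icc (0 : ℝ) 1 := by simp
  have h1 : (1 : ℝ) ∈ Icc (0 : ℝ) 1 := by simp
  have hs := intervalIntegral.integral_add_adjacent_intervals
    (intervalIntegrable_of_integrableOn_unit hi h0 (one_sub_mem_Icc ht))
    (intervalIntegrable_of_integrableOn_unit hi (one_sub_mem_Icc ht) h1)
  have e : sqrtWeight (reverseWeight φ η) t (φ 1 x) =
      1 - 1 / 2 * (∫ s in (1 - t)..1, η s x) / sqrtWeight η 1 x := by
    simp only [sqrtWeight.eq_def (reverseWeight φ η), reverseWeight, h.isDiffeo_one.invFun_apply,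
      intervalIntegral.integral_neg, intervalIntegral.integral_div]
    rw [intervalIntegral.integral_comp_sub_left (fun s => η s x), sub_zero]
    ring
  rw [e, eq_div_iff hx.ne', sub_mul, div_mul_cancel₀ _ hx.ne']
  simp only [sqrtWeight, ← hs]
  ring

/-- The change of variables from `ν` to `μ` produces the factor `sqrtWeight η 1 ^ 2`, which cancels
the squared denominator of `reverseWeight`. -/
theorem Admissible.weightEnergy_reverse (h : Admissible F μ v φ η)
    (hν : ν.toMeasure = transformed μ φ η 1) :
    weightEnergy ν.toMeasure (reverseFlow φ) (reverseWeight φ η) =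
      weightEnergy μ.toMeasure φ η := by
  have hrev := h.isFlow.reverse h.memLp_field
  have hvrev : MemLp (fun t => -v (1 - t)) 2 unitTime :=
    (h.memLp_field.comp_measurePreserving measurePreserving_one_sub).neg
  rw [weightEnergy, weightEnergy,
    ← measurePreserving_one_sub.lintegral_comp_emb measurableEmbedding_one_sub
      fun t => ∫⁻ x, ENNReal.ofReal (η t x ^ 2) ∂tilt (φ t) μ.toMeasure]
  refine lintegral_congr_ae ?_
  filter_upwards [ae_unitTime_mem] with t ht
  have hcomp : reverseFlow φ t ∘ φ 1 = φ (1 - t) := funext fun x => by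
    simp only [Function.comp_apply, reverseFlow, h.isDiffeo_one.invFun_apply]
  rw [h.lintegral_tilt hν (hrev.isDiffeo hvrev ht), hcomp]
  refine lintegral_congr_ae ?_
  filter_upwards [tilt_absolutelyContinuous.ae_le h.ae_pos] with x hx
  rw [← ENNReal.ofReal_mul (sq_nonneg _), reverseWeight, h.isDiffeo_one.invFun_apply]
  congr 1
  field_simp

theorem Joins.symm {c : ℝ≥0∞} (hj : Joins F γ μ ν c) : Joins F γ ν μ c := by
  obtain ⟨v, φ, η, h, hν, rfl⟩ := hj
  have hv := h.memLp_field
  have hvrev : MemLp (fun t => -v (1 - t)) 2 unitTime :=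
    (hv.comp_measurePreserving measurePreserving_one_sub).neg
  have hrev := h.isFlow.reverse hv
  have hq := h.quasiMeasurePreserving_invFun hν
  have hmeas : AEStronglyMeasurable (Function.uncurry (reverseWeight φ η))
      (unitTime.prod (weight ν.toMeasure)) := by
    have h1 : AEStronglyMeasurable
        (fun p : ℝ × E n => η (1 - p.1) (Function.invFun (φ 1) p.2))
        (unitTime.prod (weight ν.toMeasure)) :=
      h.memLp_weight.1.comp_quasiMeasurePreserving
        (QuasiMeasurePreserving.prodMap measurePreserving_one_sub.quasiMeasurePreserving hq)
    have h2 : AEMeasurable (fun p : ℝ × E n => sqrtWeight η 1 (Function.invFun (φ 1) p.2))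
        (unitTime.prod (weight ν.toMeasure)) :=
      (h.aemeasurable.comp_quasiMeasurePreserving hq).comp_snd
    exact (h1.aemeasurable.div h2).neg.aestronglyMeasurable
  have hE := h.weightEnergy_reverse hν
  have hη : MemLp (Function.uncurry (reverseWeight φ η)) 2 (unitTime.prod (weight ν.toMeasure)) := by
    rw [hrev.memLp_weight_iff hvrev hmeas, hE,
      ← h.isFlow.memLp_weight_iff hv h.memLp_weight.1]
    exact h.memLp_weight
  have hadm : Admissible F ν (fun t => -v (1 - t)) (reverseFlow φ) (reverseWeight φ η) := by
    refine ⟨hvrev, hrev, hη, (h.ae_weight_iff hν).2 ?_⟩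
    filter_upwards [h.pos, h.sqrtWeight_reverse] with x hx hx' t ht
    rw [hx' t ht]
    exact div_pos (hx _ (one_sub_mem_Icc ht)) (hx 1 (by simp))
  refine ⟨_, _, _, hadm, ?_, ?_⟩
  · have hcomp : reverseFlow φ 1 ∘ φ 1 = id := funext fun x => by
      simp only [Function.comp_apply, reverseFlow, h.isDiffeo_one.invFun_apply, sub_self,
        h.isFlow.apply_zero, id]
    -- The final weight of the path times that of its reversal is `1`, hence the choice of `b`.
    rw [transformed, h.rescale_pushforward hν hadm.isDiffeo_one hadm.aemeasurable
      (b := fun _ => 1), hcomp, pushforward_id]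
    · simp [rescale]
    · filter_upwards [h.sqrtWeight_reverse, h.ae_pos] with x hx hx'
      rw [hx 1 (by simp), mul_div_cancel₀ _ hx'.ne']
      simp [sqrtWeight]
  · rw [energy_eq hv h.isFlow, energy_eq hvrev hrev, hE]
    congr 2
    rw [← measurePreserving_one_sub.lintegral_comp_emb measurableEmbedding_one_sub
      fun t => ENNReal.ofReal (‖v t‖ ^ 2)]
    simp only [norm_neg]

/-- The field of the concatenation of two paths. -/
def concatField (l : ℝ) (v v' : ℝ → V) : ℝ → V :=
  concat l (fun t => l⁻¹ • v t) fun t => (1 - l)⁻¹ • v' t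

/-- The flow of the concatenation of two paths. -/
def concatFlow (l : ℝ) (φ φ' : ℝ → E n → E n) : ℝ → E n → E n :=
  concat l φ fun t => φ' t ∘ φ 1

/-- The weight control of the concatenation of two paths. -/
def concatWeight (l : ℝ) (φ : ℝ → E n → E n) (η η' : ℝ → E n → ℝ) : ℝ → E n → ℝ :=
  concat l (fun t x => l⁻¹ * η t x) fun t x => (1 - l)⁻¹ * (sqrtWeight η 1 x * η' t (φ 1 x))

variable {l : ℝ}

/-- Running a path in time `l` multiplies the squared speed by `l⁻²` and the duration by `l`. -/
theorem lintegral_concatField (hl : 0 < l) (hl1 : l < 1) :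
    ∫⁻ t, ENNReal.ofReal (‖concatField l v v' t‖ ^ 2) ∂unitTime =
      ENNReal.ofReal l⁻¹ * (∫⁻ t, ENNReal.ofReal (‖v t‖ ^ 2) ∂unitTime) +
      ENNReal.ofReal (1 - l)⁻¹ * ∫⁻ t, ENNReal.ofReal (‖v' t‖ ^ 2) ∂unitTime := by
  have hl' : 0 < 1 - l := sub_pos.2 hl1
  have key : ∀ (r : ℝ) (w : ℝ → V), 0 < r → ENNReal.ofReal r *
      ∫⁻ t, ENNReal.ofReal (‖r⁻¹ • w t‖ ^ 2) ∂unitTime =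
      ENNReal.ofReal r⁻¹ * ∫⁻ t, ENNReal.ofReal (‖w t‖ ^ 2) ∂unitTime := by
    intro r w hr
    rw [← lintegral_const_mul' _ _ ENNReal.ofReal_ne_top,
      ← lintegral_const_mul' _ _ ENNReal.ofReal_ne_top]
    refine lintegral_congr fun t => ?_
    rw [← ENNReal.ofReal_mul hr.le, ← ENNReal.ofReal_mul (inv_pos.2 hr).le, norm_smul,
      Real.norm_of_nonneg (inv_pos.2 hr).le]
    congr 1
    field_simp
  simp only [concatField, map_concat (fun x : V => ENNReal.ofReal (‖x‖ ^ 2))]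
  rw [lintegral_concat hl hl1, key l v hl, key (1 - l) v' hl']

theorem memLp_concatField (hl : 0 < l) (hl1 : l < 1) (hv : MemLp v 2 unitTime)
    (hv' : MemLp v' 2 unitTime) : MemLp (concatField l v v') 2 unitTime := by
  rw [memLp_two_iff_lintegral_sq, lintegral_concatField hl hl1]
  · exact ENNReal.add_lt_top.2
      ⟨ENNReal.mul_lt_top ENNReal.ofReal_lt_top ((memLp_two_iff_lintegral_sq hv.1).1 hv),
      ENNReal.mul_lt_top ENNReal.ofReal_lt_top ((memLp_two_iff_lintegral_sq hv'.1).1 hv')⟩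
  · exact aestronglyMeasurable_concat hl hl1 (hv.1.const_smul _) (hv'.1.const_smul _)

theorem sub_div_mem_Icc (hl1 : l < 1) {t : ℝ} (hlt : l ≤ t) (ht : t ≤ 1) :
    (t - l) / (1 - l) ∈ Icc (0 : ℝ) 1 :=
  ⟨div_nonneg (sub_nonneg.2 hlt) (sub_pos.2 hl1).le,
    (div_le_one (sub_pos.2 hl1)).2 (by linarith)⟩

theorem div_mem_Icc (hl : 0 < l) {t : ℝ} (ht : 0 ≤ t) (htl : t ≤ l) : t / l ∈ Icc (0 : ℝ) 1 :=
  ⟨div_nonneg ht hl.le, (div_le_one hl).2 htl⟩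

theorem IsFlow.concat (hl : 0 < l) (hl1 : l < 1) (hφ : IsFlow F v φ) (hφ' : IsFlow F v' φ')
    (hv : MemLp v 2 unitTime) (hv' : MemLp v' 2 unitTime) :
    IsFlow F (concatField l v v') (concatFlow l φ φ') := by
  intro x
  have hl' : 0 < 1 - l := sub_pos.2 hl1
  have hat : ∀ t, concatFlow l φ φ' t x =
      LddmmFR.concat l (fun t => φ t x) (fun t => φ' t (φ 1 x)) t := fun t =>
    map_concat (fun f : E n → E n => f x) l _ _ t
  have hmatch : (fun t => φ t x) 1 = (fun t => φ' t (φ 1 x)) 0 := (hφ'.apply_zero _).symm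
  have hf := integrableOn_field_comp F hv (hφ x).1
  have hg := integrableOn_field_comp F hv' (hφ' (φ 1 x)).1
  have hf' : IntegrableOn (fun s => l⁻¹ • F.field (v s) (φ s x)) (Icc 0 1) := hf.smul l⁻¹
  have hg' : IntegrableOn (fun s => (1 - l)⁻¹ • F.field (v' s) (φ' s (φ 1 x))) (Icc 0 1) :=
    hg.smul (1 - l)⁻¹
  have hfield : ∀ t, F.field (concatField l v v' t) (concatFlow l φ φ' t x) =
      LddmmFR.concat l (fun s => l⁻¹ • F.field (v s) (φ s x))
        (fun s => (1 - l)⁻¹ • F.field (v' s) (φ' s (φ 1 x))) t := by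
    intro t
    rw [hat, concatField, map₂_concat (fun u z => F.field u z)]
    simp only [map_smul, Pi.smul_apply]
  refine ⟨?_, fun t ht => ?_⟩
  · have hun : Icc (0 : ℝ) 1 = Icc 0 l ∪ Icc l 1 := (Icc_union_Icc_eq_Icc hl.le hl1.le).symm
    simp only [hat]
    rw [hun]
    refine ContinuousOn.union_of_isClosed ?_ ?_ isClosed_Icc isClosed_Icc
    · refine ContinuousOn.congr (f := fun t => φ (t / l) x) ?_ fun t ht => concat_of_le _ _ ht.2
      exact (hφ x).1.comp (by fun_prop) fun t ht => div_mem_Icc hl ht.1 ht.2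
    · refine ContinuousOn.congr (f := fun t => φ' ((t - l) / (1 - l)) (φ 1 x)) ?_
        fun t ht => concat_of_ge hl hmatch ht.1
      exact (hφ' (φ 1 x)).1.comp (by fun_prop) fun t ht => sub_div_mem_Icc hl1 ht.1 ht.2
  · simp only [hfield]
    rcases le_total t l with htl | htl
    · rw [integral_concat_of_le hl _ _ htl, hat, concat_of_le _ _ htl,
        intervalIntegral.integral_smul, smul_smul, mul_inv_cancel₀ hl.ne', one_smul]
      exact (hφ x).2 _ (div_mem_Icc hl ht.1 htl)
    · rw [integral_concat_of_ge hl hl1 hf' hg' htl ht.2, hat,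
        concat_of_ge hl hmatch htl, intervalIntegral.integral_smul, smul_smul,
        mul_inv_cancel₀ hl.ne', one_smul, intervalIntegral.integral_smul, smul_smul,
        mul_inv_cancel₀ hl'.ne', one_smul, ← add_assoc, ← (hφ x).2 1 (by simp)]
      exact (hφ' (φ 1 x)).2 _ (sub_div_mem_Icc hl1 htl ht.2)

/-- On the second leg the increment of the weight is `sqrtWeight η 1 x` times the increment of the
second path's weight at `φ 1 x`, so the square-root weights multiply. -/
theorem Admissible.sqrtWeight_concat (hl : 0 < l) (hl1 : l < 1) (h : Admissible F μ v φ η)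
    (hν : ν.toMeasure = transformed μ φ η 1) (h' : Admissible F ν v' φ' η') :
    ∀ᵐ x ∂weight μ.toMeasure, ∀ t ∈ Icc (0 : ℝ) 1,
      sqrtWeight (concatWeight l φ η η') t x =
        if t ≤ l then sqrtWeight η (t / l) x
        else sqrtWeight η 1 x * sqrtWeight η' ((t - l) / (1 - l)) (φ 1 x) := by
  have hl' : 0 < 1 - l := sub_pos.2 hl1
  filter_upwards [ae_integrableOn_of_memLp h.memLp_weight,
    (h.ae_weight_iff hν).1 (ae_integrableOn_of_memLp h'.memLp_weight)] with x hi hi' t ht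
  have hat : ∀ t, concatWeight l φ η η' t x =
      concat l (fun t => l⁻¹ * η t x) (fun t => (1 - l)⁻¹ * (sqrtWeight η 1 x * η' t (φ 1 x))) t :=
    fun t => map_concat (fun f : E n → ℝ => f x) l _ _ t
  rw [sqrtWeight]
  simp only [hat]
  split_ifs with htl
  · rw [integral_concat_of_le hl _ _ htl, intervalIntegral.integral_const_mul, smul_eq_mul,
      mul_inv_cancel_left₀ hl.ne', sqrtWeight]
  · rw [integral_concat_of_ge hl hl1 (hi.const_mul _) ((hi'.const_mul _).const_mul _)
      (not_le.1 htl).le ht.2, intervalIntegral.integral_const_mul,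
      intervalIntegral.integral_const_mul, intervalIntegral.integral_const_mul, smul_eq_mul,
      smul_eq_mul, mul_inv_cancel_left₀ hl.ne', mul_inv_cancel_left₀ hl'.ne']
    simp only [sqrtWeight]
    ring

/-- The factor `sqrtWeight η 1` in the second control, once squared, is the density in
`Admissible.lintegral_tilt`, so the second leg costs what it costs starting from `ν`. -/
theorem Admissible.weightEnergy_concat (hl : 0 < l) (hl1 : l < 1) (h : Admissible F μ v φ η)
    (hν : ν.toMeasure = transformed μ φ η 1) (h' : Admissible F ν v' φ' η') :
    weightEnergy μ.toMeasure (concatFlow l φ φ') (concatWeight l φ η η') =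
      ENNReal.ofReal l⁻¹ * weightEnergy μ.toMeasure φ η +
        ENNReal.ofReal (1 - l)⁻¹ * weightEnergy ν.toMeasure φ' η' := by
  have hl' : 0 < 1 - l := sub_pos.2 hl1
  have key : ∀ (r : ℝ) (m : Measure (E n)) (f : E n → ℝ), 0 < r →
      ENNReal.ofReal r * ∫⁻ x, ENNReal.ofReal ((r⁻¹ * f x) ^ 2) ∂m =
      ENNReal.ofReal r⁻¹ * ∫⁻ x, ENNReal.ofReal (f x ^ 2) ∂m := by
    intro r m f hr
    rw [← lintegral_const_mul' _ _ ENNReal.ofReal_ne_top,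
      ← lintegral_const_mul' _ _ ENNReal.ofReal_ne_top]
    refine lintegral_congr fun t => ?_
    rw [← ENNReal.ofReal_mul hr.le, ← ENNReal.ofReal_mul (inv_pos.2 hr).le]
    congr 1
    field_simp
  simp only [weightEnergy, concatFlow, concatWeight]
  simp only [map₂_concat (fun (g : E n → ℝ) (f : E n → E n) =>
    ∫⁻ x, ENNReal.ofReal (g x ^ 2) ∂tilt f μ.toMeasure)]
  rw [lintegral_concat hl hl1]
  rw [← lintegral_const_mul' _ _ ENNReal.ofReal_ne_top,
    ← lintegral_const_mul' _ _ ENNReal.ofReal_ne_top,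
    ← lintegral_const_mul' _ _ ENNReal.ofReal_ne_top,
    ← lintegral_const_mul' _ _ ENNReal.ofReal_ne_top]
  congr 1
  · exact lintegral_congr fun t => key l _ _ hl
  · refine lintegral_congr_ae ?_
    filter_upwards [ae_unitTime_mem] with t ht
    rw [key (1 - l) _ _ hl', h.lintegral_tilt hν (h'.isDiffeo ht)]
    simp only [mul_pow, ENNReal.ofReal_mul (sq_nonneg _)]

/-- The switching time `l` is left free, to be optimised in the triangle inequality. -/
theorem Joins.trans {c c' : ℝ≥0∞} (hl : 0 < l) (hl1 : l < 1) (hj : Joins F γ μ ν c)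
    (hj' : Joins F γ ν ρ c') :
    Joins F γ μ ρ (ENNReal.ofReal l⁻¹ * c + ENNReal.ofReal (1 - l)⁻¹ * c') := by
  obtain ⟨v, φ, η, h, hν, rfl⟩ := hj
  obtain ⟨v', φ', η', h', hρ, rfl⟩ := hj'
  have hv := memLp_concatField hl hl1 h.memLp_field h'.memLp_field
  have hφ := IsFlow.concat hl hl1 h.isFlow h'.isFlow h.memLp_field h'.memLp_field
  have hE := h.weightEnergy_concat hl hl1 hν h'
  have hmeas : AEStronglyMeasurable (Function.uncurry (concatWeight l φ η η'))
      (unitTime.prod (weight μ.toMeasure)) := by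
    refine aestronglyMeasurable_uncurry_concat hl hl1 (h.memLp_weight.1.const_mul _) ?_
    have h1 : AEStronglyMeasurable (fun p : ℝ × E n => η' p.1 (φ 1 p.2))
        (unitTime.prod (weight μ.toMeasure)) :=
      h'.memLp_weight.1.comp_quasiMeasurePreserving (QuasiMeasurePreserving.prodMap
        (Measure.QuasiMeasurePreserving.id unitTime) (h.quasiMeasurePreserving hν))
    exact ((h.aemeasurable.comp_snd.mul h1.aemeasurable).const_mul _).aestronglyMeasurable
  have hη : MemLp (Function.uncurry (concatWeight l φ η η')) 2
      (unitTime.prod (weight μ.toMeasure)) := by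
    rw [hφ.memLp_weight_iff hv hmeas, hE]
    exact ENNReal.add_lt_top.2 ⟨ENNReal.mul_lt_top ENNReal.ofReal_lt_top
      ((h.isFlow.memLp_weight_iff h.memLp_field h.memLp_weight.1).1 h.memLp_weight),
      ENNReal.mul_lt_top ENNReal.ofReal_lt_top
      ((h'.isFlow.memLp_weight_iff h'.memLp_field h'.memLp_weight.1).1 h'.memLp_weight)⟩
  have hadm : Admissible F μ (concatField l v v') (concatFlow l φ φ')
      (concatWeight l φ η η') := by
    refine ⟨hv, hφ, hη, ?_⟩
    filter_upwards [h.pos, (h.ae_weight_iff hν).1 h'.pos, h.sqrtWeight_concat hl hl1 hν h']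
      with x hx hx' hs t ht
    rw [hs t ht]
    split_ifs with htl
    · exact hx _ (div_mem_Icc hl ht.1 htl)
    · exact mul_pos (hx 1 (by simp)) (hx' _ (sub_div_mem_Icc hl1 (not_le.1 htl).le ht.2))
  refine ⟨_, _, _, hadm, ?_, ?_⟩
  · have hone : concatFlow l φ φ' 1 = φ' 1 ∘ φ 1 := by
      rw [concatFlow, concat_of_lt _ _ hl1, div_self (sub_pos.2 hl1).ne']
    rw [hρ, transformed, transformed, hone]
    refine h.rescale_pushforward hν h'.isDiffeo_one h'.aemeasurable ?_
    filter_upwards [h.sqrtWeight_concat hl hl1 hν h'] with x hx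
    rw [hx 1 (by simp), if_neg hl1.not_ge, div_self (sub_pos.2 hl1).ne']
  · rw [energy_eq h.memLp_field h.isFlow, energy_eq h'.memLp_field h'.isFlow, energy_eq hv hφ, hE,
      lintegral_concatField hl hl1]
    ring

end Paths

/-! ### Separation -/

section Separation

variable {n d : ℕ} {V : Type*} [NormedAddCommGroup V] [InnerProductSpace ℝ V]
  {F : FieldSpace n V} {γ : ℝ} {μ ν : Varifold n d} {v : ℝ → V} {φ : ℝ → E n → E n}
  {η : ℝ → E n → ℝ}

theorem ofReal_sq_flowConst_le (F : FieldSpace n V) (hv : MemLp v 2 unitTime) :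
    ENNReal.ofReal (flowConst F v ^ 2) ≤
      ENNReal.ofReal (F.embConst ^ 2) * ∫⁻ t, ENNReal.ofReal (‖v t‖ ^ 2) ∂unitTime := by
  rw [flowConst, mul_pow, ENNReal.ofReal_mul (sq_nonneg _), integral_unitTime]
  gcongr
  simpa using ofReal_sq_norm_integral_le hv.1.norm

theorem Admissible.lintegral_sqrtWeight_sub_one_le (h : Admissible F μ v φ η) :
    ∫⁻ x, ENNReal.ofReal (‖sqrtWeight η 1 x - 1‖ ^ 2) ∂weight μ.toMeasure ≤
      ENNReal.ofReal (jacobianBound d (Real.exp (flowConst F v))) *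
        weightEnergy μ.toMeasure φ η := by
  refine le_trans ?_ (h.isFlow.le_weightEnergy h.memLp_field)
  rw [lintegral_lintegral_swap
    (h.memLp_weight.1.aemeasurable.pow_const 2).ennreal_ofReal]
  refine lintegral_mono_ae ?_
  filter_upwards [ae_integrableOn_of_memLp h.memLp_weight] with x hx
  have h1 := ofReal_sq_norm_integral_le (m := unitTime) hx.1
  simp only [Real.norm_eq_abs, sq_abs] at h1 ⊢
  refine le_trans (ENNReal.ofReal_le_ofReal ?_) h1
  rw [sqrtWeight, integral_unitTime]
  -- The factor `1 / 4`, from the `1 / 2` in `sqrtWeight`, is discarded.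
  nlinarith [sq_nonneg (∫ s, η s x ∂unitTime)]

/-- Writing the mass of `s` as an integral against the fixed measure `μ` lets Fatou's lemma act on a
sequence of paths. -/
theorem Admissible.measure_apply (h : Admissible F μ v φ η)
    (hν : ν.toMeasure = transformed μ φ η 1) {s : Set (E n × OrientedGrassmannian n d)}
    (hs : MeasurableSet s) :
    ν.toMeasure s = ∫⁻ p, (pushMap (φ 1) ⁻¹' s).indicator (fun p =>
      ENNReal.ofReal (sqrtWeight η 1 p.1 ^ 2) * pushDensity (φ 1) p) p ∂μ.toMeasure := by
  have hT := h.isDiffeo_one.measurable_pushMap (d := d)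
  have ha : AEMeasurable (fun p : E n × OrientedGrassmannian n d =>
      ENNReal.ofReal (sqrtWeight η 1 p.1 ^ 2)) μ.toMeasure :=
    ((h.aemeasurable.pow_const 2).comp_measurable measurable_fst).ennreal_ofReal
  rw [hν, h.transformed_eq, pushforward_eq, rescale,
    ← withDensity_mul₀ ha h.isDiffeo_one.measurable_pushDensity.aemeasurable,
    Measure.map_apply hT hs, withDensity_apply _ (hT hs), lintegral_indicator (hT hs)]
  rfl

theorem tendsto_of_tendsto_ofReal_sq {ι : Type*} {l : Filter ι} {a : ι → ℝ}
    (h : Tendsto (fun i => ENNReal.ofReal (a i ^ 2)) l (𝓝 0)) : Tendsto a l (𝓝 0) := by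
  have h1 : Tendsto (fun i => a i ^ 2) l (𝓝 0) := by
    have := (ENNReal.tendsto_toReal ENNReal.zero_ne_top).comp h
    simpa [Function.comp_def, ENNReal.toReal_ofReal, sq_nonneg] using this
  have h2 := (Real.continuous_sqrt.tendsto 0).comp h1
  simp only [Function.comp_def, Real.sqrt_sq_eq_abs, Real.sqrt_zero] at h2
  exact tendsto_zero_iff_abs_tendsto_zero _ |>.2 h2

/-- Lower semicontinuity on open sets: each path of the sequence expresses the same number `ν O` as
an integral over `μ`, and the integrands tend to `1` almost everywhere on `O`. -/
theorem Joins.measure_le_of_isOpen (hγ : 0 < γ)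
    (h : ∀ ε : ℝ≥0∞, 0 < ε → ∃ c < ε, Joins F γ μ ν c)
    {O : Set (E n × OrientedGrassmannian n d)} (hO : IsOpen O) :
    μ.toMeasure O ≤ ν.toMeasure O := by
  have hε : Tendsto (fun k : ℕ => ((k : ℝ≥0∞) + 1)⁻¹) atTop (𝓝 0) := by
    have := ENNReal.tendsto_inv_nat_nhds_zero.comp (tendsto_add_atTop_nat 1)
    simpa [Function.comp_def] using this
  have hex : ∀ k : ℕ, ∃ v φ η, Admissible F μ v φ η ∧ ν.toMeasure = transformed μ φ η 1 ∧
      energy γ μ v φ η ≤ ((k : ℝ≥0∞) + 1)⁻¹ := by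
    intro k
    obtain ⟨c, hc, v, φ, η, h1, h2, rfl⟩ := h ((k : ℝ≥0∞) + 1)⁻¹
      (ENNReal.inv_pos.2 (ENNReal.add_ne_top.2 ⟨ENNReal.natCast_ne_top k, ENNReal.one_ne_top⟩))
    exact ⟨v, φ, η, h1, h2, hc.le⟩
  choose v φ η hadm hν hen using hex
  have hen0 : Tendsto (fun k => energy γ μ (v k) (φ k) (η k)) atTop (𝓝 0) :=
    tendsto_of_tendsto_of_tendsto_of_le_of_le tendsto_const_nhds hε (fun _ => zero_le) hen
  have hV : Tendsto (fun k => ∫⁻ t, ENNReal.ofReal (‖v k t‖ ^ 2) ∂unitTime) atTop (𝓝 0) := by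
    have h2 := ENNReal.Tendsto.const_mul (a := ENNReal.ofReal 2) hen0 (Or.inr ENNReal.ofReal_ne_top)
    rw [mul_zero] at h2
    refine tendsto_of_tendsto_of_tendsto_of_le_of_le tendsto_const_nhds h2 (fun _ => zero_le)
      fun k => ?_
    rw [energy, mul_add, ← mul_assoc,
      ← ENNReal.ofReal_mul zero_le_two, mul_one_div_cancel two_ne_zero, ENNReal.ofReal_one, one_mul]
    exact le_self_add
  have hW : Tendsto (fun k => weightEnergy μ.toMeasure (φ k) (η k)) atTop (𝓝 0) := by
    have h2 := ENNReal.Tendsto.const_mul (a := ENNReal.ofReal (2 / γ)) hen0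
      (Or.inr ENNReal.ofReal_ne_top)
    rw [mul_zero] at h2
    refine tendsto_of_tendsto_of_tendsto_of_le_of_le tendsto_const_nhds h2 (fun _ => zero_le)
      fun k => ?_
    rw [energy_eq (hadm k).memLp_field (hadm k).isFlow, mul_add, ← mul_assoc, ← mul_assoc,
      ← ENNReal.ofReal_mul (div_pos two_pos hγ).le (q := γ / 2),
      show 2 / γ * (γ / 2) = 1 by field_simp, ENNReal.ofReal_one, one_mul]
    exact le_add_self
  have hκ : Tendsto (fun k => flowConst F (v k)) atTop (𝓝 0) := by
    refine tendsto_of_tendsto_ofReal_sq ?_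
    have h2 := ENNReal.Tendsto.const_mul (a := ENNReal.ofReal (F.embConst ^ 2)) hV
      (Or.inr ENNReal.ofReal_ne_top)
    rw [mul_zero] at h2
    exact tendsto_of_tendsto_of_tendsto_of_le_of_le tendsto_const_nhds h2 (fun _ => zero_le)
      fun k => ofReal_sq_flowConst_le F (hadm k).memLp_field
  have hexp : Tendsto (fun k => Real.exp (flowConst F (v k))) atTop (𝓝 1) := by
    rw [← Real.exp_zero]
    exact (Real.continuous_exp.tendsto 0).comp hκ
  have hα : Tendsto (fun k => eLpNorm (sqrtWeight (η k) 1 - 1) 2 (weight μ.toMeasure)) atTop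
      (𝓝 0) := by
    -- Only boundedness counts: the prefactor tends to `jacobianBound d 1`, which need not be `1`,
    -- while the energy it multiplies tends to `0`.
    have hJ : Continuous fun K : ℝ => ENNReal.ofReal (jacobianBound d K) := by
      unfold jacobianBound
      exact ENNReal.continuous_ofReal.comp (by fun_prop)
    have h2 := ENNReal.Tendsto.mul ((hJ.tendsto 1).comp hexp) (Or.inr ENNReal.zero_ne_top) hW
      (Or.inr ENNReal.ofReal_ne_top)
    rw [mul_zero] at h2
    have h3 := tendsto_of_tendsto_of_tendsto_of_le_of_le tendsto_const_nhds h2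
      (fun _ => zero_le) fun k => (hadm k).lintegral_sqrtWeight_sub_one_le
    have h4 := ((ENNReal.continuous_rpow_const (y := 1 / 2)).tendsto 0).comp h3
    rw [ENNReal.zero_rpow_of_pos (by norm_num)] at h4
    simp only [eLpNorm_two_eq]
    exact h4
  obtain ⟨ns, hns, hae⟩ := (tendstoInMeasure_of_tendsto_eLpNorm two_ne_zero
    (fun k => (hadm k).aemeasurable.aestronglyMeasurable)
    aestronglyMeasurable_one hα).exists_seq_tendsto_ae
  have hae' : ∀ᵐ p ∂μ.toMeasure,
      Tendsto (fun i => sqrtWeight (η (ns i)) 1 (p : E n × OrientedGrassmannian n d).1) atTop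
        (𝓝 1) := ae_of_ae_map measurable_fst.aemeasurable hae
  have h1 : (1 : ℝ) ∈ Icc (0 : ℝ) 1 := by simp
  have hD : ∀ x, Tendsto (fun k => fderiv ℝ (φ k 1) x) atTop
      (𝓝 (ContinuousLinearMap.id ℝ (E n))) := by
    intro x
    rw [tendsto_iff_norm_sub_tendsto_zero]
    have h2 := hκ.mul hexp
    rw [zero_mul] at h2
    exact squeeze_zero (fun _ => norm_nonneg _)
      (fun k => (hadm k).isFlow.norm_fderiv_sub_id_le (hadm k).memLp_field h1 x) h2
  have hx : ∀ x, Tendsto (fun k => φ k 1 x) atTop (𝓝 x) := by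
    intro x
    rw [tendsto_iff_norm_sub_tendsto_zero]
    exact squeeze_zero (fun _ => norm_nonneg _)
      (fun k => (hadm k).isFlow.norm_apply_sub_le (hadm k).memLp_field h1 x) hκ
  have hT : ∀ p : E n × OrientedGrassmannian n d,
      Tendsto (fun k => pushMap (φ k 1) p) atTop (𝓝 p) := fun p =>
    (hx p.1).prodMk_nhds
      (tendsto_transport_id (hD p.1) (fun k => (hadm k).isDiffeo_one.injective_fderiv _) p.2)
  have hJ : ∀ p : E n × OrientedGrassmannian n d,
      Tendsto (fun k => pushDensity (φ k 1) p) atTop (𝓝 1) := fun p => by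
    rw [← ENNReal.ofReal_one]
    exact ENNReal.tendsto_ofReal (tendsto_jacobian_id (hD p.1) p.2)
  set f : ℕ → E n × OrientedGrassmannian n d → ℝ≥0∞ := fun i =>
    (pushMap (φ (ns i) 1) ⁻¹' O).indicator (fun p =>
      ENNReal.ofReal (sqrtWeight (η (ns i)) 1 p.1 ^ 2) * pushDensity (φ (ns i) 1) p) with hf
  have hfm : ∀ i, AEMeasurable (f i) μ.toMeasure := fun i =>
    ((((hadm _).aemeasurable.pow_const 2).comp_measurable measurable_fst).ennreal_ofReal.mul
      (hadm _).isDiffeo_one.measurable_pushDensity.aemeasurable).indicator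
      ((hadm _).isDiffeo_one.measurable_pushMap hO.measurableSet)
  have hfν : ∀ i, ∫⁻ p, f i p ∂μ.toMeasure = ν.toMeasure O := fun i =>
    ((hadm (ns i)).measure_apply (hν (ns i)) hO.measurableSet).symm
  calc μ.toMeasure O = ∫⁻ p, O.indicator 1 p ∂μ.toMeasure :=
        (lintegral_indicator_one hO.measurableSet).symm
    _ ≤ ∫⁻ p, liminf (fun i => f i p) atTop ∂μ.toMeasure := by
        refine lintegral_mono_ae ?_
        filter_upwards [hae'] with p hp
        by_cases hpO : p ∈ O
        · have hlim : Tendsto (fun i => f i p) atTop (𝓝 1) := by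
            have hw : Tendsto (fun i => ENNReal.ofReal (sqrtWeight (η (ns i)) 1 p.1 ^ 2) *
                pushDensity (φ (ns i) 1) p) atTop (𝓝 1) := by
              have h2 := ENNReal.Tendsto.mul (ENNReal.tendsto_ofReal (hp.pow 2))
                (Or.inr ENNReal.one_ne_top) ((hJ p).comp hns.tendsto_atTop)
                (Or.inr ENNReal.ofReal_ne_top)
              simpa using h2
            -- Openness of `O` enters here: the images of `p` converge to `p ∈ O`, so the indicator
            -- is eventually active.
            refine hw.congr' ?_
            filter_upwards [((hT p).comp hns.tendsto_atTop).eventually (hO.mem_nhds hpO)] with i hi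
            have hi' : p ∈ pushMap (φ (ns i) 1) ⁻¹' O := hi
            simp only [hf, indicator_of_mem hi']
          rw [hlim.liminf_eq, indicator_of_mem hpO, Pi.one_apply]
        · rw [indicator_of_notMem hpO]
          exact zero_le
    _ ≤ liminf (fun i => ∫⁻ p, f i p ∂μ.toMeasure) atTop := lintegral_liminf_le' hfm
    _ = ν.toMeasure O := by simp only [hfν, liminf_const]

/-- Reversal gives the opposite inequality on open sets, a π-system generating the Borel sets. Thus
no separation property of the Grassmannian's topology is used. -/
theorem Joins.eq_of_forall_lt (hγ : 0 < γ)
    (h : ∀ ε : ℝ≥0∞, 0 < ε → ∃ c < ε, Joins F γ μ ν c) : μ = ν := by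
  have h' : ∀ ε : ℝ≥0∞, 0 < ε → ∃ c < ε, Joins F γ ν μ c := fun ε hε => by
    obtain ⟨c, hc, hj⟩ := h ε hε
    exact ⟨c, hc, hj.symm⟩
  have hopen : ∀ O : Set (E n × OrientedGrassmannian n d), IsOpen O →
      μ.toMeasure O = ν.toMeasure O := fun O hO =>
    le_antisymm (measure_le_of_isOpen hγ h hO) (measure_le_of_isOpen hγ h' hO)
  have heq : μ.toMeasure = ν.toMeasure := ext_of_generate_finite {O | IsOpen O}
    BorelSpace.measurable_eq isPiSystem_isOpen (fun O hO => hopen O hO) (hopen univ isOpen_univ)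
  exact Subtype.ext heq

end Separation

/-! ### The distance -/

section Distance

variable {n d : ℕ} {V : Type*} [NormedAddCommGroup V] [InnerProductSpace ℝ V]
  {F : FieldSpace n V} {γ : ℝ} {μ ν ρ : Varifold n d}

theorem distFR_eq (F : FieldSpace n V) (γ : ℝ) (μ ν : Varifold n d) :
    distFR F γ μ ν = (sInf {c | Joins F γ μ ν c}) ^ (1 / 2 : ℝ) := rfl

theorem Joins.ne_top {c : ℝ≥0∞} (h : Joins F γ μ ν c) : c ≠ ⊤ := by
  obtain ⟨v, φ, η, h, -, rfl⟩ := h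
  exact h.energy_ne_top γ

theorem exists_joins_of_mem_orbit (γ : ℝ) (h : ν ∈ orbit F μ) : ∃ c, Joins F γ μ ν c := by
  obtain ⟨v, φ, η, h, hν⟩ := h
  exact ⟨_, v, φ, η, h, hν, rfl⟩

theorem Joins.distFR_le {c : ℝ≥0∞} (h : Joins F γ μ ν c) :
    distFR F γ μ ν ≤ c ^ (1 / 2 : ℝ) :=
  ENNReal.rpow_le_rpow (sInf_le h) (by norm_num)

theorem exists_joins_lt_of_distFR_lt {A : ℝ≥0∞} (h : distFR F γ μ ν < A) :
    ∃ c < A ^ 2, Joins F γ μ ν c := by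
  have h1 : sInf {c | Joins F γ μ ν c} < A ^ 2 := by
    rw [distFR_eq, one_div, ENNReal.rpow_inv_lt_iff two_pos, ENNReal.rpow_ofNat] at h
    exact h
  obtain ⟨c, hc, hcA⟩ := sInf_lt_iff.1 h1
  exact ⟨c, hcA, hc⟩

theorem distFR_ne_top (hμ : μ ∈ orbit F ρ) (hν : ν ∈ orbit F ρ) : distFR F γ μ ν ≠ ⊤ := by
  obtain ⟨c, hc⟩ := exists_joins_of_mem_orbit γ hμ
  obtain ⟨c', hc'⟩ := exists_joins_of_mem_orbit γ hν
  have h := hc.symm.trans (l := 1 / 2) (by norm_num) (by norm_num) hc'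
  exact ne_top_of_le_ne_top (ENNReal.rpow_ne_top_of_nonneg (by norm_num) h.ne_top) h.distFR_le

theorem distFR_comm (F : FieldSpace n V) (γ : ℝ) (μ ν : Varifold n d) :
    distFR F γ μ ν = distFR F γ ν μ := by
  rw [distFR_eq, distFR_eq]
  congr 2
  ext c
  exact ⟨Joins.symm, Joins.symm⟩

theorem distFR_triangle (F : FieldSpace n V) (γ : ℝ) (μ ν ρ : Varifold n d) :
    distFR F γ μ ρ ≤ distFR F γ μ ν + distFR F γ ν ρ := by
  refine ENNReal.le_of_forall_pos_le_add fun ε hε htop => ?_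
  obtain ⟨ha, hb⟩ := ENNReal.add_ne_top.1 htop.ne
  -- Adding `ε / 2` makes `A` and `B` positive even when a distance vanishes, so `A / (A + B)` lies
  -- strictly between `0` and `1`.
  set A : ℝ := (distFR F γ μ ν).toReal + ε / 2 with hA
  set B : ℝ := (distFR F γ ν ρ).toReal + ε / 2 with hB
  have hε' : (0 : ℝ) < ε := hε
  have hA0 : 0 < A := by positivity
  have hB0 : 0 < B := by positivity
  have hAB : 0 < A + B := by positivity
  have haA : distFR F γ μ ν < ENNReal.ofReal A :=
    (ENNReal.lt_ofReal_iff_toReal_lt ha).2 (by linarith)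
  have hbB : distFR F γ ν ρ < ENNReal.ofReal B :=
    (ENNReal.lt_ofReal_iff_toReal_lt hb).2 (by linarith)
  obtain ⟨c, hc, hj⟩ := exists_joins_lt_of_distFR_lt haA
  obtain ⟨c', hc', hj'⟩ := exists_joins_lt_of_distFR_lt hbB
  have hl1 : 1 - A / (A + B) = B / (A + B) := by field_simp; ring
  -- This `l` minimises `A² / l + B² / (1 - l)`, with minimum `(A + B)²`.
  have h := hj.trans (l := A / (A + B)) (by positivity)
    (by rw [div_lt_one hAB]; linarith) hj'
  refine h.distFR_le.trans ?_
  have hsum : ENNReal.ofReal (A / (A + B))⁻¹ * c + ENNReal.ofReal (1 - A / (A + B))⁻¹ * c' ≤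
      ENNReal.ofReal (A + B) ^ 2 := by
    rw [hl1]
    calc _ ≤ ENNReal.ofReal (A / (A + B))⁻¹ * ENNReal.ofReal A ^ 2 +
          ENNReal.ofReal (B / (A + B))⁻¹ * ENNReal.ofReal B ^ 2 := by gcongr
      _ = _ := by
        rw [← ENNReal.ofReal_pow hA0.le, ← ENNReal.ofReal_pow hB0.le, ← ENNReal.ofReal_pow hAB.le,
          ← ENNReal.ofReal_mul (by positivity), ← ENNReal.ofReal_mul (by positivity),
          ← ENNReal.ofReal_add (by positivity) (by positivity)]
        congr 1
        field_simp
  calc _ ≤ (ENNReal.ofReal (A + B) ^ 2) ^ (1 / 2 : ℝ) :=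
        ENNReal.rpow_le_rpow hsum (by norm_num)
    _ = ENNReal.ofReal (A + B) := by
        rw [← ENNReal.rpow_ofNat, ← ENNReal.rpow_mul]; norm_num
    _ = ENNReal.ofReal ((distFR F γ μ ν).toReal + (distFR F γ ν ρ).toReal + ε) := by
        congr 1; rw [hA, hB]; ring
    _ = _ := by
        rw [ENNReal.ofReal_add (by positivity) hε'.le,
          ENNReal.ofReal_add ENNReal.toReal_nonneg ENNReal.toReal_nonneg,
          ENNReal.ofReal_toReal ha, ENNReal.ofReal_toReal hb, ENNReal.ofReal_coe_nnreal]

theorem distFR_eq_zero_iff (hγ : 0 < γ) : distFR F γ μ ν = 0 ↔ μ = ν := by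
  constructor
  · intro h
    refine Joins.eq_of_forall_lt (F := F) hγ fun ε hε => ?_
    rw [distFR_eq, ENNReal.rpow_eq_zero_iff_of_pos (by norm_num)] at h
    rw [← h] at hε
    obtain ⟨c, hc, hcε⟩ := sInf_lt_iff.1 hε
    exact ⟨c, hcε, hc⟩
  · rintro rfl
    have h := (Joins.refl F γ μ).distFR_le
    rw [ENNReal.zero_rpow_of_pos (by norm_num)] at h
    exact le_antisymm h zero_le

end Distance

end LddmmFR

end

theorem theorem1 {n d : ℕ} (hn : 2 ≤ n) (hd : d ≤ n)
    {V : Type*} [NormedAddCommGroup V] [InnerProductSpace ℝ V] [CompleteSpace V]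
    (F : LddmmFR.FieldSpace n V) {γ : ℝ} (hγ : 0 < γ) (μ₀ : LddmmFR.Varifold n d) :
    (∀ μ ∈ LddmmFR.orbit F μ₀, ∀ ν ∈ LddmmFR.orbit F μ₀, LddmmFR.distFR F γ μ ν ≠ ⊤) ∧
    (∀ μ ∈ LddmmFR.orbit F μ₀, ∀ ν ∈ LddmmFR.orbit F μ₀,
      LddmmFR.distFR F γ μ ν = LddmmFR.distFR F γ ν μ) ∧
    (∀ μ ∈ LddmmFR.orbit F μ₀, ∀ ν ∈ LddmmFR.orbit F μ₀, ∀ ρ ∈ LddmmFR.orbit F μ₀,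
      LddmmFR.distFR F γ μ ρ ≤ LddmmFR.distFR F γ μ ν + LddmmFR.distFR F γ ν ρ) ∧
    (∀ μ ∈ LddmmFR.orbit F μ₀, ∀ ν ∈ LddmmFR.orbit F μ₀,
      LddmmFR.distFR F γ μ ν = 0 ↔ μ = ν) :=
  ⟨fun _ hμ _ hν => LddmmFR.distFR_ne_top hμ hν,
    fun μ _ ν _ => LddmmFR.distFR_comm F γ μ ν,
    fun μ _ ν _ ρ _ => LddmmFR.distFR_triangle F γ μ ν ρ,
    fun _ _ _ _ => LddmmFR.distFR_eq_zero_iff hγ⟩
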